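/- Let $\mathrm{RA}_{\mathrm{sql}}$ be the typed bag relational algebra with nulls whose terms are numerical constants, ordinary constants, $\mathrm{NULL}$, attribute names and applications of numerical functions $f\in\Omega$; whose expressions are built from the relations of a schema $\mathcal S$ by generalized projection with renaming, selection $\sigma_\theta$, product, bag union, intersection and difference, duplicate elimination, and grouping with aggregate functions from $\Omega$; and whose conditions $\theta$ are built by $\neg,\wedge,\vee$ from true, false, $\mathrm{isnull}(t)$, $\bar t\,\omega\,\bar t'$, $\bar t\in E$, $\mathrm{empty}(E)$, $\bar t\,\omega\,\mathrm{any}(E)$ and $\bar t\,\omega\,\mathrm{all}(E)$, where $\omega\in\{=,\neq,<,>,\le,\ge\}$. Let $\mathrm{RA}^{\mathrm{rec}}_{\mathrm{sql}}$ be its extension by the iteration $\mu R.E$ of SQL's WITH RECURSIVE, with $E$ of the form $E_1\cup E_2$ or $E_1\sqcup E_2$. Expressions are well typed, and names do not repeat in the attribute list of an expression. Assume that the natural numbers are among the numerical values and that $\Omega$ contains the aggregate COUNT and the remainder function $n \bmod m$. The SQL semantics $[\![\cdot]\!]$ evaluates conditions in Kleene's three-valued logic; a comparison of terms $t\,\omega\,t'$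 is unknown if one of the two values is $\mathrm{NULL}$, and has its usual value otherwise. Comparisons of tuples are Boolean combinations of comparisons of their components; $\bar t\in E$ and $\bar t\,\omega\,\mathrm{any}(E)$ are the disjunctions of $\bar t=\bar t'$ and of $\bar t\,\omega\,\bar t'$, respectively, over all records $\bar t'$ of the result of $E$, counted with multiplicity, and $\bar t\,\omega\,\mathrm{all}(E)$ is the corresponding conjunction (the empty disjunction is false, the empty conjunction is true). Selection keeps the records on which the condition is true. Let $\mathsf{MVL}$ be a many-valued logic with a finite set $\mathbf T$ of truth values, among them two distinct values true and false, whose connectives $\neg,\wedge,\vee$ extend the Boolean ones, and in which $\wedge$ and $\vee$ are associative and commutative. A semantics $[\![\cdot]\!]'$ based on $\mathsf{MVL}$ assigns to every comparison of two values a truth value in $\mathbf T$, and otherwise follows the rules of SQL with the connectives of $\mathsf{MVL}$. Let $\mathcal L$ be $\mathrm{RA}_{\mathrm{sql}}$ or $\mathrm{RA}^{\mathrm{rec}}_{\mathrm{sql}}$, and assume that $[\![\cdot]\!]'$ is SQL-expressible for atomic predicates: 1. a comparison of two non-null values has its usual truth value (true or false); 2. for each truth value $\tau\in\mathbf T$,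 each comparison $\omega$ and all terms $t,t'$ that can be compared by $\omega$ there is a condition $\theta_{\omega,\tau}(t,t')$ of $\mathcal L$, whose evaluation always terminates and which uses no parameters other than those of $t$ and $t'$, such that, for every database and every environment, $\theta_{\omega,\tau}(t,t')$ is true in the SQL semantics if and only if $t\,\omega\,t'$ has the truth value $\tau$ in $[\![\cdot]\!]'$. Then $[\![\cdot]\!]'$ captures the SQL semantics of $\mathcal L$, that is: 1. for every expression $E$ of $\mathcal L$ there is an expression $G$ of $\mathcal L$, with the same attribute names, such that $[\![E]\!]'_D=[\![G]\!]_D$ for every database $D$; 2. for every expression $E$ of $\mathcal L$ there is an expression $F$ of $\mathcal L$, with the same attribute names, such that $[\![E]\!]_D=[\![F]\!]'_D$ for every database $D$; 3. $[\![E]\!]_D=[\![E]\!]'_D$ for every expression $E$ of $\mathcal L$ in which the constant $\mathrm{NULL}$ does not occur and every database $D$ without nulls. (Equality of values of recursive expressions means that both iterations terminate with the same result or neither terminates.) -/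

import Mathlib

namespace RASQL

noncomputable section

open Classical

/-! ## Data model -/

/-- The two column types: ordinary and numerical. -/
inductive Ty
  | ord
  | num

/-- The basic vocabulary: names, numerical values and ordinary values (values of the two kinds are
kept apart in `Value`), together with the collection `Ω` of numerical functions and aggregate
functions.  The natural numbers are among the numerical values, in their usual order. -/
structure Vocab where
  /-- attribute names -/
  Name : Type
  /-- numerical values -/
  Num : Type
  /-- ordinary values -/
  Val : Type
  /-- the type of a name -/
  ty : Name → Ty
  name_countable : Countable Name
  /-- there are infinitely many names of each type -/
  name_infinite : ∀ τ : Ty, {N | ty N = τ}.Infinite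
  num_countable : Countable Num
  val_countable : Countable Val
  val_infinite : Infinite Val
  /-- the order used by the comparison predicates on numerical values -/
  numOrder : LinearOrder Num
  /-- the natural numbers as numerical values -/
  nat : ℕ ↪o Num
  /-- symbols of the numerical functions in `Ω` -/
  Fn : Type
  arity : Fn → ℕ
  /-- the numerical functions in `Ω` -/
  fn : (f : Fn) → (Fin (arity f) → Num) → Num
  /-- symbols of the aggregate functions in `Ω` -/
  Agg : Type
  /-- the aggregate functions in `Ω`: from bags of numerical values to numerical values -/
  agg : Agg → Multiset Num → Num

attribute [instance] Vocab.numOrder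

/-- `Ω` contains the aggregate `COUNT`. -/
def Vocab.HasCount (V : Vocab) : Prop :=
  ∃ F : V.Agg, ∀ B : Multiset V.Num, V.agg F B = V.nat (Multiset.card B)

/-- `Ω` contains a binary function that computes remainders of natural numbers. -/
def Vocab.HasMod (V : Vocab) : Prop :=
  ∃ (f : V.Fn) (h : V.arity f = 2), ∀ n m : ℕ, 0 < m →
    V.fn f (fun i => V.nat (![n, m] (Fin.cast h i))) = V.nat (n % m)

variable {V : Vocab}

/-- Entries of records: numerical values, ordinary values, and `NULL`. -/
inductive Value (V : Vocab)
  | num (n : V.Num)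
  | val (c : V.Val)
  | null

/-- The value may occur in a column of the given type. -/
def Value.HasTy : Value V → Ty → Prop
  | .num _, τ => τ = Ty.num
  | .val _, τ => τ = Ty.ord
  | .null, _ => True

/-- The number contained in a value, if it is one. -/
def Value.num? : Value V → Option V.Num
  | .num n => some n
  | _ => none

/-- A relation symbol `R` comes with the sequence `ℓ(R)` of its attribute names. -/
structure RelSym (V : Vocab) where
  id : ℕ
  attrs : List V.Name

abbrev Row (V : Vocab) := List (Value V)

/-- Finite bags of records. -/
abbrev Bag (V : Vocab) := Multiset (Row V)

/-- A record consistent with a sequence of names. -/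
def RowTyped (a : Row V) (Ns : List V.Name) : Prop :=
  List.Forall₂ (fun (v : Value V) N => v.HasTy (V.ty N)) a Ns

/-- A database assigns bags to relation symbols; only its values on the symbols of the schema in
question matter. -/
abbrev Database (V : Vocab) := RelSym V → Bag V

/-- `D` is a database over the schema `S`. -/
def Database.Over (D : Database V) (S : Set (RelSym V)) : Prop :=
  ∀ R ∈ S, ∀ a ∈ D R, RowTyped a R.attrs

/-- No `NULL` occurs in the relations of `D` over the schema `S`. -/
def Database.NullFree (D : Database V) (S : Set (RelSym V)) : Prop :=
  ∀ R ∈ S, ∀ a ∈ D R, Value.null ∉ a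

/-- Environments.  A name that is not in scope has the value `NULL`; well-formed expressions never
read such names. -/
abbrev Env (V : Vocab) := V.Name → Value V

def Env.empty : Env V := fun _ => Value.null

def Env.Typed (η : Env V) : Prop := ∀ N, (η N).HasTy (V.ty N)

/-- `η` overridden by the environment that maps the names `Ns` to the entries of `a`. -/
def Env.extend (η : Env V) (Ns : List V.Name) (a : Row V) : Env V :=
  fun N => if N ∈ Ns then a.getD (Ns.idxOf N) Value.null else η N

/-! ## Syntax -/

/-- Terms. -/
inductive Term (V : Vocab)
  | num (n : V.Num)
  | val (c : V.Val)
  | null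
  | name (N : V.Name)
  | app (f : V.Fn) (args : Fin (V.arity f) → Term V)

/-- Comparison predicates. -/
inductive Op
  | eq
  | ne
  | lt
  | gt
  | le
  | ge

/-- The comparison is one of `<`, `>`, `≤`, `≥`, which apply to numerical values only. -/
def Op.IsOrder : Op → Prop
  | .eq | .ne => False
  | _ => True

mutual

/-- Expressions.  Every column of a projection and of an aggregation carries its output name
explicitly; `mu R false E₁ E₂` is `μR.(E₁ ∪ E₂)` and `mu R true E₁ E₂` is `μR.(E₁ ⊔ E₂)`. -/
inductive Expr (V : Vocab)
  | rel (R : RelSym V)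
  | proj (cols : List (Term V × V.Name)) (E : Expr V)
  | sel (θ : Cond V) (E : Expr V)
  | prod (E₁ E₂ : Expr V)
  | union (E₁ E₂ : Expr V)
  | inter (E₁ E₂ : Expr V)
  | diff (E₁ E₂ : Expr V)
  | dedup (E : Expr V)
  /-- grouping by `keys`; `(F, N, N')` in `aggs` stands for the column `F(N) → N'` -/
  | group (keys : List V.Name) (aggs : List (V.Agg × V.Name × V.Name)) (E : Expr V)
  | mu (R : RelSym V) (distinct : Bool) (E₁ E₂ : Expr V)

/-- Conditions. -/
inductive Cond (V : Vocab)
  | tt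
  | ff
  | isnull (t : Term V)
  | cmp (ts : List (Term V)) (ω : Op) (ts' : List (Term V))
  | mem (ts : List (Term V)) (E : Expr V)
  | empty (E : Expr V)
  | any (ts : List (Term V)) (ω : Op) (E : Expr V)
  | all (ts : List (Term V)) (ω : Op) (E : Expr V)
  | or (θ₁ θ₂ : Cond V)
  | and (θ₁ θ₂ : Cond V)
  | not (θ : Cond V)

end

/-- The sequence `ℓ(E)` of attribute names of an expression. -/
def Expr.attrs : Expr V → List V.Name
  | .rel R => R.attrs
  | .proj cols _ => cols.map Prod.snd
  | .sel _ E => E.attrs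
  | .prod E₁ E₂ => E₁.attrs ++ E₂.attrs
  | .union E₁ _ => E₁.attrs
  | .inter E₁ _ => E₁.attrs
  | .diff E₁ _ => E₁.attrs
  | .dedup E => E.attrs
  | .group keys aggs _ => keys ++ aggs.map (fun c => c.2.2)
  | .mu R _ _ _ => R.attrs

/-- The type of an expression. -/
def Expr.type (E : Expr V) : List Ty := E.attrs.map V.ty

/-! ### Well-formed expressions -/

/-- The term uses only the names in `Γ` and has type `τ` (`NULL` has both types). -/
def Term.HasTy (Γ : Set V.Name) : Term V → Ty → Prop
  | .num _, τ => τ = Ty.num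
  | .val _, τ => τ = Ty.ord
  | .null, _ => True
  | .name N, τ => N ∈ Γ ∧ V.ty N = τ
  | .app _ args, τ => τ = Ty.num ∧ ∀ i, (args i).HasTy Γ Ty.num

/-- `t ω t'` is a well-formed comparison of terms over the names in `Γ`. -/
def CmpOK (Γ : Set V.Name) (ω : Op) (t t' : Term V) : Prop :=
  ∃ τ, t.HasTy Γ τ ∧ t'.HasTy Γ τ ∧ (ω.IsOrder → τ = Ty.num)

/-- The tuple `ts` is nonempty and can be compared by `ω` with records over the names `Ns`. -/
def SubqueryOK (Γ : Set V.Name) (ω : Op) (ts : List (Term V)) (Ns : List V.Name) : Prop :=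
  ts ≠ [] ∧ List.Forall₂ (fun (t : Term V) N =>
    t.HasTy Γ (V.ty N) ∧ (ω.IsOrder → V.ty N = Ty.num)) ts Ns

mutual

/-- `E` is well-typed and well-scoped over the schema `S`: `Δ` is the set of relation symbols bound
by an enclosing `μ`, and `Γ` the set of names available from enclosing queries.  Names do not
repeat in `ℓ(E)`. -/
def Expr.WF (S : Set (RelSym V)) : Expr V → Set (RelSym V) → Set V.Name → Prop
  | .rel R, Δ, _ => (R ∈ S ∨ R ∈ Δ) ∧ R.attrs.Nodup
  | .proj cols E, Δ, Γ => E.WF S Δ Γ ∧ (cols.map Prod.snd).Nodup ∧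
      ∀ c ∈ cols, c.1.HasTy (Γ ∪ {N | N ∈ E.attrs}) (V.ty c.2)
  | .sel θ E, Δ, Γ => E.WF S Δ Γ ∧ θ.WF S Δ (Γ ∪ {N | N ∈ E.attrs})
  | .prod E₁ E₂, Δ, Γ => E₁.WF S Δ Γ ∧ E₂.WF S Δ Γ ∧ E₁.attrs.Disjoint E₂.attrs
  | .union E₁ E₂, Δ, Γ => E₁.WF S Δ Γ ∧ E₂.WF S Δ Γ ∧ E₁.type = E₂.type
  | .inter E₁ E₂, Δ, Γ => E₁.WF S Δ Γ ∧ E₂.WF S Δ Γ ∧ E₁.type = E₂.type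
  | .diff E₁ E₂, Δ, Γ => E₁.WF S Δ Γ ∧ E₂.WF S Δ Γ ∧ E₁.type = E₂.type
  | .dedup E, Δ, Γ => E.WF S Δ Γ
  | .group keys aggs E, Δ, Γ => E.WF S Δ Γ ∧ (keys ++ aggs.map (fun c => c.2.2)).Nodup ∧
      (∀ N ∈ keys, N ∈ E.attrs) ∧
      ∀ c ∈ aggs, c.2.1 ∈ E.attrs ∧ V.ty c.2.1 = Ty.num ∧ V.ty c.2.2 = Ty.num
  | .mu R _ E₁ E₂, Δ, Γ => R ∉ S ∧ E₁.WF S Δ Γ ∧ E₂.WF S (insert R Δ) Γ ∧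
      E₁.attrs = R.attrs ∧ E₂.type = R.attrs.map V.ty

/-- The same for conditions. -/
def Cond.WF (S : Set (RelSym V)) : Cond V → Set (RelSym V) → Set V.Name → Prop
  | .tt, _, _ => True
  | .ff, _, _ => True
  | .isnull t, _, Γ => ∃ τ, t.HasTy Γ τ
  | .cmp ts ω ts', _, Γ => ts ≠ [] ∧ List.Forall₂ (CmpOK Γ ω) ts ts'
  | .mem ts E, Δ, Γ => E.WF S Δ Γ ∧ SubqueryOK Γ Op.eq ts E.attrs
  | .empty E, Δ, Γ => E.WF S Δ Γ
  | .any ts ω E, Δ, Γ => E.WF S Δ Γ ∧ SubqueryOK Γ ω ts E.attrs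
  | .all ts ω E, Δ, Γ => E.WF S Δ Γ ∧ SubqueryOK Γ ω ts E.attrs
  | .or θ₁ θ₂, Δ, Γ => θ₁.WF S Δ Γ ∧ θ₂.WF S Δ Γ
  | .and θ₁ θ₂, Δ, Γ => θ₁.WF S Δ Γ ∧ θ₂.WF S Δ Γ
  | .not θ, Δ, Γ => θ.WF S Δ Γ

end

mutual

/-- The expression contains no recursion. -/
def Expr.NonRec : Expr V → Prop
  | .rel _ => True
  | .proj _ E => E.NonRec
  | .sel θ E => θ.NonRec ∧ E.NonRec
  | .prod E₁ E₂ => E₁.NonRec ∧ E₂.NonRec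
  | .union E₁ E₂ => E₁.NonRec ∧ E₂.NonRec
  | .inter E₁ E₂ => E₁.NonRec ∧ E₂.NonRec
  | .diff E₁ E₂ => E₁.NonRec ∧ E₂.NonRec
  | .dedup E => E.NonRec
  | .group _ _ E => E.NonRec
  | .mu _ _ _ _ => False

/-- The condition contains no recursion. -/
def Cond.NonRec : Cond V → Prop
  | .tt => True
  | .ff => True
  | .isnull _ => True
  | .cmp _ _ _ => True
  | .mem _ E => E.NonRec
  | .empty E => E.NonRec
  | .any _ _ E => E.NonRec
  | .all _ _ E => E.NonRec
  | .or θ₁ θ₂ => θ₁.NonRec ∧ θ₂.NonRec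
  | .and θ₁ θ₂ => θ₁.NonRec ∧ θ₂.NonRec
  | .not θ => θ.NonRec

end

/-- The constant `NULL` does not occur in the term. -/
def Term.NoNull : Term V → Prop
  | .num _ => True
  | .val _ => True
  | .null => False
  | .name _ => True
  | .app _ args => ∀ i, (args i).NoNull

mutual

/-- The constant `NULL` does not occur in the expression. -/
def Expr.NoNull : Expr V → Prop
  | .rel _ => True
  | .proj cols E => (∀ c ∈ cols, c.1.NoNull) ∧ E.NoNull
  | .sel θ E => θ.NoNull ∧ E.NoNull
  | .prod E₁ E₂ => E₁.NoNull ∧ E₂.NoNull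
  | .union E₁ E₂ => E₁.NoNull ∧ E₂.NoNull
  | .inter E₁ E₂ => E₁.NoNull ∧ E₂.NoNull
  | .diff E₁ E₂ => E₁.NoNull ∧ E₂.NoNull
  | .dedup E => E.NoNull
  | .group _ _ E => E.NoNull
  | .mu _ _ E₁ E₂ => E₁.NoNull ∧ E₂.NoNull

/-- The constant `NULL` does not occur in the condition. -/
def Cond.NoNull : Cond V → Prop
  | .tt => True
  | .ff => True
  | .isnull t => t.NoNull
  | .cmp ts _ ts' => (∀ t ∈ ts, t.NoNull) ∧ ∀ t ∈ ts', t.NoNull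
  | .mem ts E => (∀ t ∈ ts, t.NoNull) ∧ E.NoNull
  | .empty E => E.NoNull
  | .any ts _ E => (∀ t ∈ ts, t.NoNull) ∧ E.NoNull
  | .all ts _ E => (∀ t ∈ ts, t.NoNull) ∧ E.NoNull
  | .or θ₁ θ₂ => θ₁.NoNull ∧ θ₂.NoNull
  | .and θ₁ θ₂ => θ₁.NoNull ∧ θ₂.NoNull
  | .not θ => θ.NoNull

end

/-- The two languages. -/
inductive Lang
  /-- `RA_sql`, without recursion -/
  | raSql
  /-- `RA^rec_sql`, with recursion -/
  | raRec

/-- `E` is an expression of the language over the schema `S`, without parameters. -/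
def Lang.IsExpr (L : Lang) (S : Set (RelSym V)) (E : Expr V) : Prop :=
  E.WF S ∅ ∅ ∧ (L = Lang.raSql → E.NonRec)

/-- `θ` is a condition of the language over the schema `S`, with parameters among `Γ`. -/
def Lang.IsCond (L : Lang) (S : Set (RelSym V)) (Γ : Set V.Name) (θ : Cond V) : Prop :=
  θ.WF S ∅ Γ ∧ (L = Lang.raSql → θ.NonRec)

/-! ## Many-valued logics -/

/-- A many-valued logic with truth values `Truth` whose connectives extend the Boolean ones, with
associative and commutative `∧` and `∨`.  (Other connectives do not occur in conditions.) -/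
structure MVL (Truth : Type) where
  tt : Truth
  ff : Truth
  tt_ne_ff : tt ≠ ff
  neg : Truth → Truth
  and : Truth → Truth → Truth
  or : Truth → Truth → Truth
  neg_tt : neg tt = ff
  neg_ff : neg ff = tt
  and_tt_tt : and tt tt = tt
  and_tt_ff : and tt ff = ff
  and_ff_tt : and ff tt = ff
  and_ff_ff : and ff ff = ff
  or_tt_tt : or tt tt = tt
  or_tt_ff : or tt ff = tt
  or_ff_tt : or ff tt = tt
  or_ff_ff : or ff ff = ff
  and_assoc : Std.Associative and
  and_comm : Std.Commutative and
  or_assoc : Std.Associative or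
  or_comm : Std.Commutative or

attribute [instance] MVL.and_assoc MVL.and_comm MVL.or_assoc MVL.or_comm

/-- The truth value of an ordinary two-valued statement. -/
def MVL.ofProp {T : Type} (M : MVL T) (p : Prop) : T := if p then M.tt else M.ff

/-- The iterated conjunction of a bag of truth values: `tt` for the empty bag; for a nonempty bag
only its elements are combined, since `tt` need not be neutral. -/
def MVL.conj {T : Type} (M : MVL T) (B : Multiset T) : T :=
  ((B.map some).fold (Option.merge M.and) none).getD M.tt

/-- The iterated disjunction of a bag of truth values: `ff` for the empty bag. -/
def MVL.disj {T : Type} (M : MVL T) (B : Multiset T) : T :=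
  ((B.map some).fold (Option.merge M.or) none).getD M.ff

/-- The truth values of SQL: true, false, unknown. -/
inductive K3
  | t
  | f
  | u

def K3.neg : K3 → K3
  | .t => .f
  | .f => .t
  | .u => .u

def K3.and : K3 → K3 → K3
  | .t, b => b
  | .f, _ => .f
  | .u, .f => .f
  | .u, _ => .u

def K3.or : K3 → K3 → K3
  | .t, _ => .t
  | .f, b => b
  | .u, .t => .t
  | .u, _ => .u

/-- Kleene's three-valued logic. -/
def kleene : MVL K3 where
  tt := .t
  ff := .f
  tt_ne_ff := by simp
  neg := K3.neg
  and := K3.and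
  or := K3.or
  neg_tt := rfl
  neg_ff := rfl
  and_tt_tt := rfl
  and_tt_ff := rfl
  and_ff_tt := rfl
  and_ff_ff := rfl
  or_tt_tt := rfl
  or_tt_ff := rfl
  or_ff_tt := rfl
  or_ff_ff := rfl
  and_assoc := ⟨by intro a b c; cases a <;> cases b <;> cases c <;> rfl⟩
  and_comm := ⟨by intro a b; cases a <;> cases b <;> rfl⟩
  or_assoc := ⟨by intro a b c; cases a <;> cases b <;> cases c <;> rfl⟩
  or_comm := ⟨by intro a b; cases a <;> cases b <;> rfl⟩

/-! ## Semantics -/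

/-- A semantics is determined by a many-valued logic and the truth values of comparisons. -/
structure Semantics (V : Vocab) (T : Type) extends MVL T where
  cmp : Op → Value V → Value V → T

/-- The standard comparisons, on a linear order. -/
def Op.Holds {α : Type} [LinearOrder α] : Op → α → α → Prop
  | .eq, x, y => x = y
  | .ne, x, y => x ≠ y
  | .lt, x, y => x < y
  | .gt, x, y => x > y
  | .le, x, y => x ≤ y
  | .ge, x, y => x ≥ y

/-- The meaning of the comparisons of non-null values that occur in well-formed expressions:
all comparisons of two numerical values, and `=`, `≠` between ordinary values. -/
def Op.HoldsVal (ω : Op) : Value V → Value V → Prop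
  | .num x, .num y => ω.Holds x y
  | .val c, .val d => (ω = Op.eq ∧ c = d) ∨ (ω = Op.ne ∧ c ≠ d)
  | _, _ => False

/-- The semantics of SQL: Kleene's logic, and a comparison with `NULL` is unknown. -/
def sql (V : Vocab) : Semantics V K3 where
  toMVL := kleene
  cmp ω v v' := match v, v' with
    | .null, _ => K3.u
    | _, .null => K3.u
    | v, v' => if ω.HoldsVal v v' then K3.t else K3.f

/-- The value of a term: a function returns `NULL` if one of its arguments is `NULL`. -/
def Term.eval (η : Env V) : Term V → Value V
  | .num n => .num n
  | .val c => .val c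
  | .null => .null
  | .name N => η N
  | .app f args =>
      if h : ∀ i, ((args i).eval η).num?.isSome then
        .num (V.fn f (fun i => ((args i).eval η).num?.get (h i)))
      else .null

/-- The strict version of an order comparison. -/
def Op.strict : Op → Op
  | .le => .lt
  | .ge => .gt
  | ω => ω

/-- Comparison of tuples: `=` is the conjunction of the componentwise `=`, `≠` the disjunction of
the componentwise `≠`, and the others are lexicographic: the disjunction, over the positions `i`,
of the conjunctions saying that the components before `i` are equal and those at `i` compare
strictly, where at the last position `ω` itself is used. -/
def Semantics.cmpTuple {T : Type} (M : Semantics V T) (ω : Op) (a b : Row V) : T :=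
  match ω with
  | .eq => M.conj (List.zipWith (M.cmp Op.eq) a b : List T)
  | .ne => M.disj (List.zipWith (M.cmp Op.ne) a b : List T)
  | ω => M.disj ((List.range a.length).map (fun i =>
      M.conj ((List.zipWith (M.cmp Op.eq) a b).take i ++
        [M.cmp (if i + 1 = a.length then ω else ω.strict)
          (a.getD i Value.null) (b.getD i Value.null)] : List T)) : List T)

/-- The iteration for `μR`: the pair `(RES_i, R_i)`, where `step` evaluates the second argument of
the union on the current `R_i`; it is undefined if some evaluation is. -/
def recState (distinct : Bool) (step : Bag V → Option (Bag V)) (B₀ : Bag V) :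
    ℕ → Option (Bag V × Bag V)
  | 0 => some (if distinct then (B₀.dedup, B₀.dedup) else (B₀, B₀))
  | i + 1 =>
      (recState distinct step B₀ i).bind fun s =>
        (step s.2).bind fun B =>
          let R := if distinct then B.dedup - s.1 else B
          some (s.1 + R, R)

/-- The iteration returns `RES_i` for the first `i` with `R_i = ∅`; it has no result if there is no
such `i`. -/
def recResult (distinct : Bool) (step : Bag V → Option (Bag V)) (B₀ : Bag V) : Option (Bag V) :=
  if h : ∃ i RES, recState distinct step B₀ i = some (RES, 0) then
    (recState distinct step B₀ (Nat.find h)).map Prod.fst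
  else none

/-- The semantics of grouping: one record for each group, where `NULL` is treated as one more
constant in forming groups, and nulls are dropped before an aggregate function is applied. -/
def groupBag (η : Env V) (keys : List V.Name) (aggs : List (V.Agg × V.Name × V.Name))
    (Ns : List V.Name) (B : Bag V) : Bag V :=
  (B.map (fun a => keys.map (η.extend Ns a))).dedup.map fun k =>
    k ++ aggs.map fun c => Value.num (V.agg c.1
      ((B.filter (fun a => keys.map (η.extend Ns a) = k)).filterMap
        (fun a => (η.extend Ns a c.2.1).num?)))

mutual

/-- The result of an expression on a database under an environment; `none` means that an
iteration that has to be performed does not terminate. -/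
def Expr.eval {T : Type} (M : Semantics V T) : Expr V → Database V → Env V → Option (Bag V)
  | .rel R, D, _ => some (D R)
  | .proj cols E, D, η => (E.eval M D η).map fun B =>
      B.map fun a => cols.map fun c => c.1.eval (η.extend E.attrs a)
  | .sel θ E, D, η => (E.eval M D η).bind fun B =>
      if ∀ a ∈ B, (θ.eval M D (η.extend E.attrs a)).isSome then
        some (B.filter fun a => θ.eval M D (η.extend E.attrs a) = some M.tt)
      else none
  | .prod E₁ E₂, D, η => (E₁.eval M D η).bind fun B₁ => (E₂.eval M D η).map fun B₂ =>
      B₁.bind fun a => B₂.map fun b => a ++ b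
  | .union E₁ E₂, D, η => (E₁.eval M D η).bind fun B₁ => (E₂.eval M D η).map fun B₂ => B₁ + B₂
  | .inter E₁ E₂, D, η => (E₁.eval M D η).bind fun B₁ => (E₂.eval M D η).map fun B₂ => B₁ ∩ B₂
  | .diff E₁ E₂, D, η => (E₁.eval M D η).bind fun B₁ => (E₂.eval M D η).map fun B₂ => B₁ - B₂
  | .dedup E, D, η => (E.eval M D η).map fun B => B.dedup
  | .group keys aggs E, D, η => (E.eval M D η).map fun B => groupBag η keys aggs E.attrs B
  | .mu R distinct E₁ E₂, D, η => (E₁.eval M D η).bind fun B₀ =>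
      recResult distinct (fun B => E₂.eval M (Function.update D R B) η) B₀

/-- The truth value of a condition on a database under an environment. -/
def Cond.eval {T : Type} (M : Semantics V T) : Cond V → Database V → Env V → Option T
  | .tt, _, _ => some M.tt
  | .ff, _, _ => some M.ff
  | .isnull t, _, η => some (M.ofProp (t.eval η = Value.null))
  | .cmp ts ω ts', _, η =>
      some (M.cmpTuple ω (ts.map (Term.eval η)) (ts'.map (Term.eval η)))
  | .mem ts E, D, η => (E.eval M D η).map fun B =>
      M.disj (B.map fun b => M.cmpTuple Op.eq (ts.map (Term.eval η)) b)
  | .empty E, D, η => (E.eval M D η).map fun B => M.ofProp (B = 0)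
  | .any ts ω E, D, η => (E.eval M D η).map fun B =>
      M.disj (B.map fun b => M.cmpTuple ω (ts.map (Term.eval η)) b)
  | .all ts ω E, D, η => (E.eval M D η).map fun B =>
      M.conj (B.map fun b => M.cmpTuple ω (ts.map (Term.eval η)) b)
  | .or θ₁ θ₂, D, η => (θ₁.eval M D η).bind fun a => (θ₂.eval M D η).map fun b => M.or a b
  | .and θ₁ θ₂, D, η => (θ₁.eval M D η).bind fun a => (θ₂.eval M D η).map fun b => M.and a b
  | .not θ, D, η => (θ.eval M D η).map M.neg

end

/-- The value of an expression in a database. -/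
def Expr.value {T : Type} (M : Semantics V T) (E : Expr V) (D : Database V) : Option (Bag V) :=
  E.eval M D Env.empty

/-! ## The notions of the theorem -/

/-- The semantics `M` is SQL-expressible for atomic predicates. -/
structure Semantics.Expressible {T : Type} (M : Semantics V T) (L : Lang)
    (S : Set (RelSym V)) : Prop where
  /-- Without nulls, comparisons have their usual truth value. -/
  num_cmp : ∀ (ω : Op) (x y : V.Num), M.cmp ω (.num x) (.num y) = M.ofProp (ω.Holds x y)
  val_eq : ∀ c d : V.Val, M.cmp Op.eq (.val c) (.val d) = M.ofProp (c = d)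
  val_ne : ∀ c d : V.Val, M.cmp Op.ne (.val c) (.val d) = M.ofProp (c ≠ d)
  /-- For every truth value and comparison of terms there is a condition (whose evaluation always
  terminates) that is true in SQL if and only if the comparison has that truth value. -/
  definable : ∀ (τ : T) (ω : Op) (Γ : Set V.Name) (t t' : Term V), CmpOK Γ ω t t' →
    ∃ θ : Cond V, L.IsCond S Γ θ ∧
      ∀ (D : Database V) (η : Env V), D.Over S → η.Typed →
        ∃ b : K3, θ.eval (sql V) D η = some b ∧
          (b = K3.t ↔ M.cmp ω (t.eval η) (t'.eval η) = τ)

/-- The semantics `M` captures the SQL semantics of the language `L` over the schema `S`. -/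
structure Semantics.Captures {T : Type} (M : Semantics V T) (L : Lang)
    (S : Set (RelSym V)) : Prop where
  to_sql : ∀ E : Expr V, L.IsExpr S E → ∃ G : Expr V, L.IsExpr S G ∧ G.attrs = E.attrs ∧
    ∀ D : Database V, D.Over S → E.value M D = G.value (sql V) D
  from_sql : ∀ E : Expr V, L.IsExpr S E → ∃ F : Expr V, L.IsExpr S F ∧ F.attrs = E.attrs ∧
    ∀ D : Database V, D.Over S → E.value (sql V) D = F.value M D
  null_free : ∀ E : Expr V, L.IsExpr S E → E.NoNull →
    ∀ D : Database V, D.Over S → D.NullFree S → E.value (sql V) D = E.value M D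

end

end RASQL

namespace RASQL

open Classical

variable {V : Vocab}

/-! ## Scoping and typing -/

theorem Term.HasTy.mono {Γ Γ' : Set V.Name} (h : Γ ⊆ Γ') {t : Term V} {τ : Ty}
    (ht : t.HasTy Γ τ) : t.HasTy Γ' τ := by
  induction t generalizing τ with
  | num | val | null => exact ht
  | name N => exact ⟨h ht.1, ht.2⟩
  | app f args ih => exact ⟨ht.1, fun i => ih i (ht.2 i)⟩

theorem CmpOK.mono {Γ Γ' : Set V.Name} (h : Γ ⊆ Γ') {ω : Op} {t t' : Term V}
    (ht : CmpOK Γ ω t t') : CmpOK Γ' ω t t' :=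
  let ⟨τ, h₁, h₂, h₃⟩ := ht
  ⟨τ, h₁.mono h, h₂.mono h, h₃⟩

theorem SubqueryOK.mono {Γ Γ' : Set V.Name} (h : Γ ⊆ Γ') {ω : Op} {ts : List (Term V)}
    {Ns : List V.Name} (ht : SubqueryOK Γ ω ts Ns) : SubqueryOK Γ' ω ts Ns :=
  ⟨ht.1, ht.2.imp fun _ _ h' => ⟨h'.1.mono h, h'.2⟩⟩

mutual

theorem Expr.WF.mono {S : Set (RelSym V)} : ∀ {E : Expr V} {Δ Δ' : Set (RelSym V)}
    {Γ Γ' : Set V.Name}, Δ ⊆ Δ' → Γ ⊆ Γ' → E.WF S Δ Γ → E.WF S Δ' Γ'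
  | .rel _, _, _, _, _, hΔ, _, h => by
    simp only [Expr.WF] at h ⊢
    exact ⟨h.1.imp_right (@hΔ _), h.2⟩
  | .proj _ _, _, _, _, _, hΔ, hΓ, h => by
    simp only [Expr.WF] at h ⊢
    exact ⟨h.1.mono hΔ hΓ, h.2.1, fun c hc =>
      (h.2.2 c hc).mono (Set.union_subset_union_left _ hΓ)⟩
  | .sel _ _, _, _, _, _, hΔ, hΓ, h => by
    simp only [Expr.WF] at h ⊢
    exact ⟨h.1.mono hΔ hΓ, h.2.mono hΔ (Set.union_subset_union_left _ hΓ)⟩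
  | .prod _ _, _, _, _, _, hΔ, hΓ, h => by
    simp only [Expr.WF] at h ⊢
    exact ⟨h.1.mono hΔ hΓ, h.2.1.mono hΔ hΓ, h.2.2⟩
  | .union _ _, _, _, _, _, hΔ, hΓ, h => by
    simp only [Expr.WF] at h ⊢
    exact ⟨h.1.mono hΔ hΓ, h.2.1.mono hΔ hΓ, h.2.2⟩
  | .inter _ _, _, _, _, _, hΔ, hΓ, h => by
    simp only [Expr.WF] at h ⊢
    exact ⟨h.1.mono hΔ hΓ, h.2.1.mono hΔ hΓ, h.2.2⟩
  | .diff _ _, _, _, _, _, hΔ, hΓ, h => by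
    simp only [Expr.WF] at h ⊢
    exact ⟨h.1.mono hΔ hΓ, h.2.1.mono hΔ hΓ, h.2.2⟩
  | .dedup _, _, _, _, _, hΔ, hΓ, h => by
    simp only [Expr.WF] at h ⊢
    exact h.mono hΔ hΓ
  | .group _ _ _, _, _, _, _, hΔ, hΓ, h => by
    simp only [Expr.WF] at h ⊢
    exact ⟨h.1.mono hΔ hΓ, h.2⟩
  | .mu _ _ _ _, _, _, _, _, hΔ, hΓ, h => by
    simp only [Expr.WF] at h ⊢
    exact ⟨h.1, h.2.1.mono hΔ hΓ, h.2.2.1.mono (Set.insert_subset_insert hΔ) hΓ, h.2.2.2⟩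

theorem Cond.WF.mono {S : Set (RelSym V)} : ∀ {θ : Cond V} {Δ Δ' : Set (RelSym V)}
    {Γ Γ' : Set V.Name}, Δ ⊆ Δ' → Γ ⊆ Γ' → θ.WF S Δ Γ → θ.WF S Δ' Γ'
  | .tt, _, _, _, _, _, _, h => by simp only [Cond.WF]
  | .ff, _, _, _, _, _, _, h => by simp only [Cond.WF]
  | .isnull _, _, _, _, _, _, hΓ, h => by
    simp only [Cond.WF] at h ⊢
    exact h.imp fun _ h => h.mono hΓ
  | .cmp _ _ _, _, _, _, _, _, hΓ, h => by
    simp only [Cond.WF] at h ⊢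
    exact ⟨h.1, h.2.imp fun _ _ h => h.mono hΓ⟩
  | .mem _ _, _, _, _, _, hΔ, hΓ, h => by
    simp only [Cond.WF] at h ⊢
    exact ⟨h.1.mono hΔ hΓ, h.2.mono hΓ⟩
  | .empty _, _, _, _, _, hΔ, hΓ, h => by
    simp only [Cond.WF] at h ⊢
    exact h.mono hΔ hΓ
  | .any _ _ _, _, _, _, _, hΔ, hΓ, h => by
    simp only [Cond.WF] at h ⊢
    exact ⟨h.1.mono hΔ hΓ, h.2.mono hΓ⟩
  | .all _ _ _, _, _, _, _, hΔ, hΓ, h => by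
    simp only [Cond.WF] at h ⊢
    exact ⟨h.1.mono hΔ hΓ, h.2.mono hΓ⟩
  | .or _ _, _, _, _, _, hΔ, hΓ, h => by
    simp only [Cond.WF] at h ⊢
    exact ⟨h.1.mono hΔ hΓ, h.2.mono hΔ hΓ⟩
  | .and _ _, _, _, _, _, hΔ, hΓ, h => by
    simp only [Cond.WF] at h ⊢
    exact ⟨h.1.mono hΔ hΓ, h.2.mono hΔ hΓ⟩
  | .not _, _, _, _, _, hΔ, hΓ, h => by
    simp only [Cond.WF] at h ⊢
    exact h.mono hΔ hΓ

end

theorem Expr.WF.nodup_attrs {S : Set (RelSym V)} : ∀ {E : Expr V} {Δ : Set (RelSym V)}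
    {Γ : Set V.Name}, E.WF S Δ Γ → E.attrs.Nodup
  | .rel _, _, _, h => by
    simp only [Expr.WF] at h
    exact h.2
  | .proj _ _, _, _, h => by
    simp only [Expr.WF] at h
    exact h.2.1
  | .sel _ _, _, _, h => by
    simp only [Expr.WF] at h
    exact h.1.nodup_attrs
  | .prod _ _, _, _, h => by
    simp only [Expr.WF] at h
    exact h.1.nodup_attrs.append h.2.1.nodup_attrs h.2.2
  | .union _ _, _, _, h => by
    simp only [Expr.WF] at h
    exact h.1.nodup_attrs
  | .inter _ _, _, _, h => by
    simp only [Expr.WF] at h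
    exact h.1.nodup_attrs
  | .diff _ _, _, _, h => by
    simp only [Expr.WF] at h
    exact h.1.nodup_attrs
  | .dedup _, _, _, h => by
    simp only [Expr.WF] at h
    exact h.nodup_attrs
  | .group _ _ _, _, _, h => by
    simp only [Expr.WF] at h
    exact h.2.1
  | .mu _ _ _ _, _, _, h => by
    simp only [Expr.WF] at h
    have := h.2.1.nodup_attrs
    rwa [h.2.2.2.1] at this

theorem Term.eval_hasTy {Γ : Set V.Name} {η : Env V} (hη : η.Typed) {t : Term V} {τ : Ty}
    (ht : t.HasTy Γ τ) : (t.eval η).HasTy τ := by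
  cases t with
  | num | val | null => exact ht
  | name N => exact ht.2 ▸ hη N
  | app f args =>
    simp only [Term.eval]
    split
    · exact ht.1
    · trivial

theorem rowTyped_iff {a : Row V} {Ns : List V.Name} :
    RowTyped a Ns ↔ List.Forall₂ Value.HasTy a (Ns.map V.ty) := by
  rw [RowTyped, List.forall₂_map_right_iff]

theorem RowTyped.congr {a : Row V} {Ns Ns' : List V.Name} (h : RowTyped a Ns)
    (hN : Ns.map V.ty = Ns'.map V.ty) : RowTyped a Ns' := by
  rw [rowTyped_iff] at h ⊢
  exact hN ▸ h

theorem Env.extend_mem_or {η : Env V} {Ns : List V.Name} {a : Row V}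
    (h : Ns.length = a.length) (N : V.Name) :
    (N ∈ Ns ∧ η.extend Ns a N ∈ a) ∨ (N ∉ Ns ∧ η.extend Ns a N = η N) := by
  unfold Env.extend
  by_cases hN : N ∈ Ns
  · left
    have hi : Ns.idxOf N < a.length := h ▸ List.idxOf_lt_length_of_mem hN
    simp only [hN, if_true, true_and, List.getD_eq_getElem _ _ hi]
    exact List.getElem_mem hi
  · right
    simp [hN]

theorem Env.Typed.extend {η : Env V} (hη : η.Typed) {Ns : List V.Name} {a : Row V}
    (ha : RowTyped a Ns) : (η.extend Ns a).Typed := by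
  intro N
  unfold Env.extend
  split
  · rename_i hN
    have hi : Ns.idxOf N < Ns.length := List.idxOf_lt_length_of_mem hN
    have hi' : Ns.idxOf N < a.length := ha.length_eq ▸ hi
    have := ha.get hi' hi
    simp only [List.get_eq_getElem, List.getElem_idxOf] at this
    rwa [List.getD_eq_getElem _ _ hi']
  · exact hη N

theorem Env.typed_empty : (Env.empty : Env V).Typed := fun _ => trivial

theorem Env.map_extend {η : Env V} {Ns : List V.Name} {a : Row V} (hN : Ns.Nodup)
    (h : a.length = Ns.length) : Ns.map (η.extend Ns a) = a := by
  refine List.ext_getElem (by simp [h]) fun i h₁ h₂ => ?_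
  simp only [List.getElem_map, Env.extend, List.getElem_mem, if_true,
    hN.idxOf_getElem, List.getD_eq_getElem _ _ h₂]

@[simp]
theorem Env.extend_nil (η : Env V) (a : Row V) : η.extend [] a = η := by
  funext N
  simp [Env.extend]

/-! ## Iteration -/

theorem recState_forall {p : Row V → Prop} {distinct : Bool} {step : Bag V → Option (Bag V)}
    {B₀ : Bag V} (h₀ : ∀ a ∈ B₀, p a)
    (hstep : ∀ B, (∀ a ∈ B, p a) → ∀ B', step B = some B' → ∀ a ∈ B', p a) :
    ∀ i s, recState distinct step B₀ i = some s → (∀ a ∈ s.1, p a) ∧ ∀ a ∈ s.2, p a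
  | 0, s, h => by
    simp only [recState, Option.some.injEq] at h
    subst h
    cases distinct <;> simpa using h₀
  | i + 1, s, h => by
    simp only [recState, Option.bind_eq_some_iff, Option.some.injEq] at h
    obtain ⟨s', hs', B, hB, rfl⟩ := h
    obtain ⟨h₁, h₂⟩ := recState_forall h₀ hstep i s' hs'
    have hB' := hstep _ h₂ _ hB
    have hR : ∀ a ∈ (if distinct then B.dedup - s'.1 else B), p a := by
      intro a ha
      cases distinct
      · exact hB' a (by simpa using ha)
      · exact hB' a (Multiset.mem_dedup.1 (Multiset.mem_of_le (Multiset.sub_le_self _ _)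
          (by simpa using ha)))
    refine ⟨fun a ha => ?_, hR⟩
    rcases Multiset.mem_add.1 ha with ha | ha
    exacts [h₁ a ha, hR a ha]

theorem recResult_forall {p : Row V → Prop} {distinct : Bool} {step : Bag V → Option (Bag V)}
    {B₀ : Bag V} (h₀ : ∀ a ∈ B₀, p a)
    (hstep : ∀ B, (∀ a ∈ B, p a) → ∀ B', step B = some B' → ∀ a ∈ B', p a) {B : Bag V}
    (h : recResult distinct step B₀ = some B) : ∀ a ∈ B, p a := by
  unfold recResult at h
  split at h
  · simp only [Option.map_eq_some_iff] at h
    obtain ⟨s, hs, rfl⟩ := h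
    exact (recState_forall h₀ hstep _ s hs).1
  · simp at h

theorem recState_congr {p : Row V → Prop} {distinct : Bool} {step step' : Bag V → Option (Bag V)}
    {B₀ : Bag V} (h₀ : ∀ a ∈ B₀, p a)
    (hstep : ∀ B, (∀ a ∈ B, p a) → ∀ B', step B = some B' → ∀ a ∈ B', p a)
    (heq : ∀ B, (∀ a ∈ B, p a) → step B = step' B) :
    ∀ i, recState distinct step B₀ i = recState distinct step' B₀ i
  | 0 => rfl
  | i + 1 => by
    simp only [recState]
    rw [← recState_congr h₀ hstep heq i]
    refine Option.bind_congr fun s hs => ?_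
    rw [heq _ (recState_forall h₀ hstep i s hs).2]

theorem recResult_congr {p : Row V → Prop} {distinct : Bool}
    {step step' : Bag V → Option (Bag V)} {B₀ : Bag V} (h₀ : ∀ a ∈ B₀, p a)
    (hstep : ∀ B, (∀ a ∈ B, p a) → ∀ B', step B = some B' → ∀ a ∈ B', p a)
    (heq : ∀ B, (∀ a ∈ B, p a) → step B = step' B) :
    recResult distinct step B₀ = recResult distinct step' B₀ := by
  have : recState distinct step B₀ = recState distinct step' B₀ :=
    funext (recState_congr h₀ hstep heq)
  unfold recResult
  rw [this]

theorem recResult_zero (distinct : Bool) (step : Bag V → Option (Bag V)) :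
    recResult distinct step 0 = some 0 := by
  have h₀ : recState distinct step 0 0 = some (0, 0) := by
    cases distinct <;> simp [recState]
  have h : ∃ i RES, recState distinct step 0 i = some (RES, 0) := ⟨0, 0, h₀⟩
  have h' : Nat.find h = 0 := (Nat.find_eq_zero h).2 ⟨0, h₀⟩
  unfold recResult
  rw [dif_pos h, h', h₀]
  rfl

/-! ## Values of expressions are typed -/

theorem Database.Over.mono {D : Database V} {S S' : Set (RelSym V)} (h : D.Over S)
    (hS : S' ⊆ S) : D.Over S' := fun R hR => h R (hS hR)

theorem Database.Over.update {D : Database V} {S Δ : Set (RelSym V)} {R : RelSym V} {B : Bag V}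
    (h : D.Over (S ∪ Δ)) (hB : ∀ a ∈ B, RowTyped a R.attrs) :
    Database.Over (Function.update D R B) (S ∪ insert R Δ) := by
  intro R' hR' a ha
  by_cases hR : R' = R
  · subst hR
    exact hB a (by simpa using ha)
  · rw [Function.update_of_ne hR] at ha
    refine h R' ?_ a ha
    rcases hR' with h' | h' | h'
    exacts [Or.inl h', absurd h' hR, Or.inr h']

theorem groupBag_typed {η : Env V} (hη : η.Typed) {keys : List V.Name}
    {aggs : List (V.Agg × V.Name × V.Name)} {Ns : List V.Name} {B : Bag V}
    (hB : ∀ a ∈ B, RowTyped a Ns) (haggs : ∀ c ∈ aggs, V.ty c.2.2 = Ty.num) :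
    ∀ a ∈ groupBag η keys aggs Ns B, RowTyped a (keys ++ aggs.map fun c => c.2.2) := by
  intro a ha
  simp only [groupBag, Multiset.mem_map, Multiset.mem_dedup] at ha
  obtain ⟨_, ⟨b, hb, rfl⟩, rfl⟩ := ha
  refine List.rel_append ?_ ?_
  · simp only [List.forall₂_map_left_iff, List.forall₂_same]
    exact fun N _ => hη.extend (hB b hb) N
  · simp only [List.forall₂_map_left_iff, List.forall₂_map_right_iff, List.forall₂_same]
    exact fun c hc => haggs c hc

theorem Expr.eval_typed {T : Type} (M : Semantics V T) {S : Set (RelSym V)} :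
    ∀ {E : Expr V} {Δ : Set (RelSym V)} {Γ : Set V.Name} {D : Database V} {η : Env V} {B : Bag V},
      E.WF S Δ Γ → D.Over (S ∪ Δ) → η.Typed → E.eval M D η = some B →
        ∀ a ∈ B, RowTyped a E.attrs
  | .rel R, _, _, _, _, _, hE, hD, hη, h => by
    simp only [Expr.WF, Expr.eval, Option.some.injEq] at hE h
    subst h
    exact hD R hE.1
  | .proj cols E, _, _, _, _, _, hE, hD, hη, h => by
    simp only [Expr.WF, Expr.eval, Option.map_eq_some_iff] at hE h
    obtain ⟨B, hB, rfl⟩ := h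
    intro a ha
    obtain ⟨b, hb, rfl⟩ := Multiset.mem_map.1 ha
    simp only [Expr.attrs, RowTyped, List.forall₂_map_left_iff, List.forall₂_map_right_iff,
      List.forall₂_same]
    exact fun c hc =>
      Term.eval_hasTy (hη.extend (Expr.eval_typed M hE.1 hD hη hB b hb)) (hE.2.2 c hc)
  | .sel θ E, _, _, _, _, _, hE, hD, hη, h => by
    simp only [Expr.WF, Expr.eval, Option.bind_eq_some_iff] at hE h
    obtain ⟨B, hB, h⟩ := h
    split at h
    · obtain rfl := Option.some.inj h
      exact fun a ha => Expr.eval_typed M hE.1 hD hη hB a (Multiset.mem_filter.1 ha).1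
    · simp at h
  | .prod E₁ E₂, _, _, _, _, _, hE, hD, hη, h => by
    simp only [Expr.WF, Expr.eval, Option.bind_eq_some_iff, Option.map_eq_some_iff] at hE h
    obtain ⟨B₁, hB₁, B₂, hB₂, rfl⟩ := h
    intro a ha
    simp only [Multiset.mem_bind, Multiset.mem_map] at ha
    obtain ⟨b, hb, c, hc, rfl⟩ := ha
    exact List.rel_append (Expr.eval_typed M hE.1 hD hη hB₁ b hb)
      (Expr.eval_typed M hE.2.1 hD hη hB₂ c hc)
  | .union E₁ E₂, _, _, _, _, _, hE, hD, hη, h => by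
    simp only [Expr.WF, Expr.eval, Option.bind_eq_some_iff, Option.map_eq_some_iff] at hE h
    obtain ⟨B₁, hB₁, B₂, hB₂, rfl⟩ := h
    intro a ha
    rcases Multiset.mem_add.1 ha with ha | ha
    · exact Expr.eval_typed M hE.1 hD hη hB₁ a ha
    · exact (Expr.eval_typed M hE.2.1 hD hη hB₂ a ha).congr hE.2.2.symm
  | .inter E₁ E₂, _, _, _, _, _, hE, hD, hη, h => by
    simp only [Expr.WF, Expr.eval, Option.bind_eq_some_iff, Option.map_eq_some_iff] at hE h
    obtain ⟨B₁, hB₁, B₂, hB₂, rfl⟩ := h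
    exact fun a ha => Expr.eval_typed M hE.1 hD hη hB₁ a (Multiset.mem_inter.1 ha).1
  | .diff E₁ E₂, _, _, _, _, _, hE, hD, hη, h => by
    simp only [Expr.WF, Expr.eval, Option.bind_eq_some_iff, Option.map_eq_some_iff] at hE h
    obtain ⟨B₁, hB₁, B₂, hB₂, rfl⟩ := h
    exact fun a ha => Expr.eval_typed M hE.1 hD hη hB₁ a
      (Multiset.mem_of_le (Multiset.sub_le_self _ _) ha)
  | .dedup E, _, _, _, _, _, hE, hD, hη, h => by
    simp only [Expr.WF, Expr.eval, Option.map_eq_some_iff] at hE h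
    obtain ⟨B, hB, rfl⟩ := h
    exact fun a ha => Expr.eval_typed M hE hD hη hB a (Multiset.mem_dedup.1 ha)
  | .group keys aggs E, _, _, _, _, _, hE, hD, hη, h => by
    simp only [Expr.WF, Expr.eval, Option.map_eq_some_iff] at hE h
    obtain ⟨B, hB, rfl⟩ := h
    exact groupBag_typed hη (Expr.eval_typed M hE.1 hD hη hB) fun c hc => (hE.2.2.2 c hc).2.2
  | .mu R distinct E₁ E₂, _, _, _, _, _, hE, hD, hη, h => by
    simp only [Expr.WF, Expr.eval, Option.bind_eq_some_iff] at hE h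
    obtain ⟨B₀, hB₀, h⟩ := h
    refine recResult_forall (p := fun a => RowTyped a R.attrs) ?_ ?_ h
    · exact hE.2.2.2.1 ▸ Expr.eval_typed M hE.2.1 hD hη hB₀
    · exact fun B hB B' hB' a ha =>
        (Expr.eval_typed M hE.2.2.1 (hD.update hB) hη hB' a ha).congr hE.2.2.2.2

/-! ## Two-valued conditions -/

section OfProp

variable {T : Type} (M : MVL T)

theorem MVL.ofProp_eq_tt {p : Prop} : M.ofProp p = M.tt ↔ p := by
  unfold MVL.ofProp
  split <;> simp_all [M.tt_ne_ff.symm]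

theorem MVL.neg_ofProp (p : Prop) : M.neg (M.ofProp p) = M.ofProp (¬p) := by
  by_cases p <;> simp_all [MVL.ofProp, M.neg_tt, M.neg_ff]

theorem MVL.and_ofProp (p q : Prop) : M.and (M.ofProp p) (M.ofProp q) = M.ofProp (p ∧ q) := by
  by_cases p <;> by_cases q <;>
    simp_all [MVL.ofProp, M.and_tt_tt, M.and_tt_ff, M.and_ff_tt, M.and_ff_ff]

theorem MVL.or_ofProp (p q : Prop) : M.or (M.ofProp p) (M.ofProp q) = M.ofProp (p ∨ q) := by
  by_cases p <;> by_cases q <;>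
    simp_all [MVL.ofProp, M.or_tt_tt, M.or_tt_ff, M.or_ff_tt, M.or_ff_ff]

theorem MVL.ofProp_true : M.ofProp True = M.tt := if_pos trivial

theorem MVL.ofProp_false : M.ofProp False = M.ff := if_neg id

end OfProp

/-- `E` is an expression of the language over the schema `S`, inside the scope of iterations that
bind the relation symbols in `Δ` and of queries with the names in `Γ`. -/
def Lang.IsExprIn (L : Lang) (S Δ : Set (RelSym V)) (Γ : Set V.Name) (E : Expr V) : Prop :=
  E.WF S Δ Γ ∧ (L = Lang.raSql → E.NonRec)

/-- The same for conditions. -/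
def Lang.IsCondIn (L : Lang) (S Δ : Set (RelSym V)) (Γ : Set V.Name) (θ : Cond V) : Prop :=
  θ.WF S Δ Γ ∧ (L = Lang.raSql → θ.NonRec)

section

variable {L : Lang} {S Δ : Set (RelSym V)} {Γ : Set V.Name}

theorem Lang.IsCondIn.mono {Δ' : Set (RelSym V)} {Γ' : Set V.Name} {θ : Cond V}
    (h : L.IsCondIn S Δ Γ θ) (hΔ : Δ ⊆ Δ') (hΓ : Γ ⊆ Γ') : L.IsCondIn S Δ' Γ' θ :=
  ⟨h.1.mono hΔ hΓ, h.2⟩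

theorem isCondIn_tt : L.IsCondIn S Δ Γ .tt := by simp [Lang.IsCondIn, Cond.WF, Cond.NonRec]

theorem isCondIn_ff : L.IsCondIn S Δ Γ .ff := by simp [Lang.IsCondIn, Cond.WF, Cond.NonRec]

theorem isCondIn_isnull {t : Term V} {τ : Ty} (h : t.HasTy Γ τ) :
    L.IsCondIn S Δ Γ (.isnull t) := by
  simp only [Lang.IsCondIn, Cond.WF, Cond.NonRec]
  exact ⟨⟨τ, h⟩, fun _ => trivial⟩

theorem isCondIn_cmp {ω : Op} {t t' : Term V} (h : CmpOK Γ ω t t') :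
    L.IsCondIn S Δ Γ (.cmp [t] ω [t']) := by
  simp [Lang.IsCondIn, Cond.WF, Cond.NonRec, h]

theorem Lang.IsCondIn.not {θ : Cond V} (h : L.IsCondIn S Δ Γ θ) : L.IsCondIn S Δ Γ θ.not := by
  simp only [Lang.IsCondIn, Cond.WF, Cond.NonRec]
  exact h

theorem Lang.IsCondIn.and {θ θ' : Cond V} (h : L.IsCondIn S Δ Γ θ) (h' : L.IsCondIn S Δ Γ θ') :
    L.IsCondIn S Δ Γ (θ.and θ') := by
  simp only [Lang.IsCondIn, Cond.WF, Cond.NonRec]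
  exact ⟨⟨h.1, h'.1⟩, fun hL => ⟨h.2 hL, h'.2 hL⟩⟩

theorem Lang.IsCondIn.or {θ θ' : Cond V} (h : L.IsCondIn S Δ Γ θ) (h' : L.IsCondIn S Δ Γ θ') :
    L.IsCondIn S Δ Γ (θ.or θ') := by
  simp only [Lang.IsCondIn, Cond.WF, Cond.NonRec]
  exact ⟨⟨h.1, h'.1⟩, fun hL => ⟨h.2 hL, h'.2 hL⟩⟩

theorem Lang.IsExprIn.empty {E : Expr V} (h : L.IsExprIn S Δ Γ E) :
    L.IsCondIn S Δ Γ (.empty E) := by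
  simp only [Lang.IsCondIn, Cond.WF, Cond.NonRec]
  exact h

theorem Lang.IsExprIn.sel {E : Expr V} {θ : Cond V} (h : L.IsExprIn S Δ Γ E)
    (hθ : L.IsCondIn S Δ (Γ ∪ {N | N ∈ E.attrs}) θ) : L.IsExprIn S Δ Γ (.sel θ E) := by
  simp only [Lang.IsExprIn, Expr.WF, Expr.NonRec]
  exact ⟨⟨h.1, hθ.1⟩, fun hL => ⟨hθ.2 hL, h.2 hL⟩⟩

theorem Lang.IsExprIn.proj {E : Expr V} {cols : List (Term V × V.Name)}
    (h : L.IsExprIn S Δ Γ E) (hN : (cols.map Prod.snd).Nodup)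
    (hc : ∀ c ∈ cols, c.1.HasTy (Γ ∪ {N | N ∈ E.attrs}) (V.ty c.2)) :
    L.IsExprIn S Δ Γ (.proj cols E) := by
  simp only [Lang.IsExprIn, Expr.WF, Expr.NonRec]
  exact ⟨⟨h.1, hN, hc⟩, h.2⟩

end

theorem Expr.eval_sel_of_forall {T : Type} (M : Semantics V T) {E : Expr V} {θ : Cond V}
    {D : Database V} {η : Env V} {B : Bag V} {f : Row V → T} (hE : E.eval M D η = some B)
    (hθ : ∀ a ∈ B, θ.eval M D (η.extend E.attrs a) = some (f a)) :
    (Expr.sel θ E).eval M D η = some (B.filter fun a => f a = M.tt) := by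
  simp only [Expr.eval, hE, Option.bind_some]
  rw [if_pos fun a ha => by simp [hθ a ha]]
  refine congrArg some (Multiset.filter_congr fun a ha => ?_)
  rw [hθ a ha, Option.some.injEq]

/-! ## Nonempty expressions without columns -/

/-- `U` is an expression over the schema `S` without columns; its value is nonempty if one of the
relations `bs` is. -/
structure Witnesses (S : Set (RelSym V)) (bs : List (RelSym V)) (U : Expr V) : Prop where
  attrs : U.attrs = []
  isExprIn : ∀ L Δ Γ, Lang.IsExprIn L S Δ Γ U
  eval : ∀ {T : Type} (M : Semantics V T) (D : Database V) (η : Env V),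
    ∃ B, U.eval M D η = some B ∧ ((∃ R ∈ bs, D R ≠ 0) → B ≠ 0)

theorem exists_witnesses {S : Set (RelSym V)} : ∀ {bs : List (RelSym V)}, bs ≠ [] →
    (∀ R ∈ bs, R ∈ S ∧ R.attrs.Nodup) → ∃ U, Witnesses S bs U
  | [R], _, h => by
    refine ⟨.proj [] (.rel R), rfl, fun L Δ Γ => ?_, fun M D η => ⟨(D R).map fun _ => [], ?_, ?_⟩⟩
    · have := h R (by simp)
      simp [Lang.IsExprIn, Expr.WF, Expr.NonRec, this]
    · simp [Expr.eval]
    · simp [← Multiset.card_eq_zero]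
  | R :: R' :: bs, _, h => by
    obtain ⟨U, hU⟩ := exists_witnesses (bs := R' :: bs) (by simp)
      fun R hR => h R (List.mem_cons_of_mem _ hR)
    refine ⟨.union (.proj [] (.rel R)) U, rfl, fun L Δ Γ => ?_, fun M D η => ?_⟩
    · have h₁ := h R (by simp)
      have h₂ := hU.isExprIn L Δ Γ
      simp only [Lang.IsExprIn, Expr.WF, Expr.NonRec, Expr.type, Expr.attrs, hU.attrs] at h₂ ⊢
      simp [h₁, h₂.1]
      exact h₂.2
    · obtain ⟨B, hB, hne⟩ := hU.eval M D η
      refine ⟨(D R).map (fun _ => []) + B, by simp [Expr.eval, hB], ?_⟩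
      rintro ⟨R₁, hR₁, hD⟩ h0
      rw [add_eq_zero] at h0
      rcases List.mem_cons.1 hR₁ with rfl | hR₁
      · exact hD (Multiset.map_eq_zero.1 h0.1)
      · exact hne ⟨R₁, hR₁, hD⟩ h0.2

/-- Typed databases in which one of the relations `bs` is nonempty, with a typed environment. -/
structure Admissible (S Δ : Set (RelSym V)) (bs : List (RelSym V)) (D : Database V)
    (η : Env V) : Prop where
  isOver : D.Over (S ∪ Δ)
  nonempty : ∃ R ∈ bs, D R ≠ 0
  typed : η.Typed

theorem Admissible.extend {S Δ : Set (RelSym V)} {bs : List (RelSym V)} {D : Database V}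
    {η : Env V} (h : Admissible S Δ bs D η) {Ns : List V.Name} {a : Row V} (ha : RowTyped a Ns) :
    Admissible S Δ bs D (η.extend Ns a) :=
  ⟨h.isOver, h.nonempty, h.typed.extend ha⟩

theorem Witnesses.eval_not_empty_sel {T : Type} (M : Semantics V T) {S Δ : Set (RelSym V)}
    {bs : List (RelSym V)} {U : Expr V} (hU : Witnesses S bs U) {D : Database V} {η : Env V}
    (h : Admissible S Δ bs D η) {θ : Cond V} {b : T} (hθ : θ.eval M D η = some b) :
    (Cond.not (.empty (.sel θ U))).eval M D η = some (M.ofProp (b = M.tt)) := by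
  obtain ⟨B, hB, hne⟩ := hU.eval M D η
  have := Expr.eval_sel_of_forall M (θ := θ) (f := fun _ => b) hB fun a _ => by
    rwa [hU.attrs, Env.extend_nil]
  simp only [Cond.eval, this, Option.map_some, MVL.neg_ofProp]
  by_cases hb : b = M.tt <;> simp [hb, hne h.nonempty]

/-! ## Families of conditions that represent a quantity -/

/-- There are two-valued conditions of the language that say, in the semantics `M`, that the
quantity `ev` has the value `a`, for each `a`. -/
def Represented {T A : Type} (M : Semantics V T) (L : Lang) (S : Set (RelSym V))
    (bs : List (RelSym V)) (Δ : Set (RelSym V)) (Γ : Set V.Name)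
    (ev : Database V → Env V → Option A) : Prop :=
  ∃ Φ : A → Cond V, (∀ a, L.IsCondIn S Δ Γ (Φ a)) ∧ ∀ D η, Admissible S Δ bs D η →
    ∀ a, (Φ a).eval M D η = (ev D η).map fun x => M.ofProp (x = a)

section Represented

variable {T A B X ι : Type} {M : Semantics V T} {L : Lang} {S : Set (RelSym V)}
  {bs : List (RelSym V)} {Δ : Set (RelSym V)} {Γ : Set V.Name}

theorem Represented.congr {ev ev' : Database V → Env V → Option A}
    (h : Represented M L S bs Δ Γ ev)
    (heq : ∀ D η, Admissible S Δ bs D η → ev D η = ev' D η) :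
    Represented M L S bs Δ Γ ev' := by
  obtain ⟨Φ, h₁, h₂⟩ := h
  exact ⟨Φ, h₁, fun D η hD a => by rw [h₂ D η hD, heq D η hD]⟩

theorem represented_const (a : A) : Represented M L S bs Δ Γ fun _ _ => some a := by
  refine ⟨fun a' => if a = a' then .tt else .ff, fun a' => ?_, fun D η _ a' => ?_⟩
  · dsimp only
    split
    exacts [isCondIn_tt, isCondIn_ff]
  · by_cases h : a = a' <;> simp [h, Cond.eval, MVL.ofProp]

theorem represented_of_cond {ev : Database V → Env V → Option Prop} {θ : Cond V}
    (hθ : L.IsCondIn S Δ Γ θ)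
    (h : ∀ D η, Admissible S Δ bs D η → θ.eval M D η = (ev D η).map M.ofProp) :
    Represented M L S bs Δ Γ ev := by
  refine ⟨fun p => if p then θ else .not θ, fun p => ?_, fun D η hD p => ?_⟩
  · dsimp only
    split
    exacts [hθ, hθ.not]
  · by_cases hp : p
    · simp [hp, h D η hD]
    · simp [hp, Cond.eval, h D η hD, Function.comp_def, MVL.neg_ofProp]

theorem Represented.map [Finite A] [Nonempty A] {ev : Database V → Env V → Option A}
    (h : Represented M L S bs Δ Γ ev) (g : A → B) :
    Represented M L S bs Δ Γ fun D η => (ev D η).map g := by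
  obtain ⟨Φ, h₁, h₂⟩ := h
  have key : ∀ (b : B) (l : List A), ∃ θ, L.IsCondIn S Δ Γ θ ∧
      ∀ D η, Admissible S Δ bs D η →
        θ.eval M D η = (ev D η).map fun x => M.ofProp (x ∈ l ∧ g x = b) := by
    intro b l
    induction l with
    | nil =>
      refine ⟨.and (Φ (Classical.arbitrary A)) .ff, (h₁ _).and isCondIn_ff, fun D η hD => ?_⟩
      simp only [Cond.eval, h₂ D η hD]
      cases ev D η <;> simp [← MVL.ofProp_false, MVL.and_ofProp]
    | cons a l ih =>
      obtain ⟨θ, hθ, hθ'⟩ := ih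
      by_cases hab : g a = b
      · refine ⟨.or (Φ a) θ, (h₁ a).or hθ, fun D η hD => ?_⟩
        simp only [Cond.eval, h₂ D η hD, hθ' D η hD]
        cases ev D η with
        | none => rfl
        | some x =>
          simp only [Option.map_some, Option.bind_some, MVL.or_ofProp, List.mem_cons]
          congr 2
          apply propext
          constructor
          · rintro (rfl | h)
            exacts [⟨Or.inl rfl, hab⟩, ⟨Or.inr h.1, h.2⟩]
          · rintro ⟨rfl | h, h'⟩
            exacts [Or.inl rfl, Or.inr ⟨h, h'⟩]
      · refine ⟨θ, hθ, fun D η hD => ?_⟩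
        rw [hθ' D η hD]
        congr 1
        funext x
        congr 1
        apply propext
        constructor
        · exact fun h => ⟨List.mem_cons_of_mem _ h.1, h.2⟩
        · rintro ⟨h, h'⟩
          rcases List.mem_cons.1 h with rfl | h
          exacts [absurd h' hab, ⟨h, h'⟩]
  have := Fintype.ofFinite A
  choose Ψ hΨ hΨ' using fun b => key b Finset.univ.toList
  refine ⟨Ψ, hΨ, fun D η hD b => ?_⟩
  simp [hΨ' b D η hD, Function.comp_def]

theorem Represented.pair {ev : Database V → Env V → Option A}
    {ev' : Database V → Env V → Option B} (h : Represented M L S bs Δ Γ ev)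
    (h' : Represented M L S bs Δ Γ ev') :
    Represented M L S bs Δ Γ fun D η => (ev D η).bind fun a => (ev' D η).map fun b => (a, b) := by
  obtain ⟨Φ, h₁, h₂⟩ := h
  obtain ⟨Ψ, h₁', h₂'⟩ := h'
  refine ⟨fun p => .and (Φ p.1) (Ψ p.2), fun p => (h₁ _).and (h₁' _), fun D η hD p => ?_⟩
  simp only [Cond.eval, h₂ D η hD, h₂' D η hD]
  cases ev D η <;> cases ev' D η <;> simp [MVL.and_ofProp, Prod.ext_iff]

theorem Represented.map₂ [Finite A] [Nonempty A] {ev ev' : Database V → Env V → Option A}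
    (h : Represented M L S bs Δ Γ ev) (h' : Represented M L S bs Δ Γ ev') (op : A → A → A) :
    Represented M L S bs Δ Γ fun D η => (ev D η).bind fun a => (ev' D η).map fun b => op a b := by
  refine ((h.pair h').map fun p => op p.1 p.2).congr fun D η _ => ?_
  cases ev D η <;> simp [Function.comp_def]

theorem represented_foldr [Finite A] [Nonempty A] {g : Database V → Env V → Option X}
    {f : ι → Database V → Env V → X → A} (op : A → A → A) {e : A}
    (he : Represented M L S bs Δ Γ fun D η => (g D η).map fun _ => e) (l : List ι)
    (h : ∀ i ∈ l, Represented M L S bs Δ Γ fun D η => (g D η).map (f i D η)) :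
    Represented M L S bs Δ Γ
      fun D η => (g D η).map fun x => (l.map fun i => f i D η x).foldr op e := by
  induction l with
  | nil => exact he
  | cons i l ih =>
    refine ((h i (by simp)).map₂ (ih fun j hj => h j (List.mem_cons_of_mem _ hj)) op).congr
      fun D η _ => ?_
    cases g D η <;> simp

end Represented

/-! ## Comparisons of tuples -/

/-- The comparisons of `M` are definable in the semantics `M'`. -/
def Semantics.DefinableIn {T T' : Type} (M : Semantics V T) (M' : Semantics V T') (L : Lang)
    (S : Set (RelSym V)) (bs : List (RelSym V)) : Prop :=
  ∀ (τ : T) (ω : Op) (Γ : Set V.Name) (t t' : Term V), CmpOK Γ ω t t' →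
    ∃ θ : Cond V, L.IsCondIn S ∅ Γ θ ∧ ∀ (D : Database V) (η : Env V), Admissible S ∅ bs D η →
      ∃ b : T', θ.eval M' D η = some b ∧ (b = M'.tt ↔ M.cmp ω (t.eval η) (t'.eval η) = τ)

theorem CmpOK.eq {Γ : Set V.Name} {ω : Op} {t t' : Term V} (h : CmpOK Γ ω t t') :
    CmpOK Γ .eq t t' :=
  let ⟨τ, h₁, h₂, _⟩ := h
  ⟨τ, h₁, h₂, False.elim⟩

theorem Op.IsOrder.of_strict {ω : Op} (h : ω.strict.IsOrder) : ω.IsOrder := by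
  cases ω <;> exact h

theorem CmpOK.strict {Γ : Set V.Name} {ω : Op} {t t' : Term V} (h : CmpOK Γ ω t t') :
    CmpOK Γ ω.strict t t' :=
  let ⟨τ, h₁, h₂, h₃⟩ := h
  ⟨τ, h₁, h₂, fun h => h₃ h.of_strict⟩

theorem MVL.conj_coe {T : Type} (M : MVL T) (l : List T) :
    M.conj l = ((l.map some).foldr (Option.merge M.and) none).getD M.tt := by
  simp [MVL.conj, Multiset.map_coe, Multiset.coe_fold_r]

theorem MVL.disj_coe {T : Type} (M : MVL T) (l : List T) :
    M.disj l = ((l.map some).foldr (Option.merge M.or) none).getD M.ff := by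
  simp [MVL.disj, Multiset.map_coe, Multiset.coe_fold_r]

theorem Semantics.cmpTuple_of_isOrder {T : Type} (M : Semantics V T) {ω : Op} (h : ω.IsOrder)
    (a b : Row V) :
    M.cmpTuple ω a b = M.disj ((List.range a.length).map (fun i =>
      M.conj ((List.zipWith (M.cmp Op.eq) a b).take i ++
        [M.cmp (if i + 1 = a.length then ω else ω.strict)
          (a.getD i Value.null) (b.getD i Value.null)] : List T)) : List T) := by
  cases ω <;> first | exact h.elim | rfl

theorem Semantics.cmpTuple_singleton {T : Type} (M : Semantics V T) (ω : Op) (v v' : Value V) :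
    M.cmpTuple ω [v] [v'] = M.cmp ω v v' := by
  have h₁ (x : T) : M.conj {x} = x := M.conj_coe [x]
  have h₂ (x : T) : M.disj {x} = x := M.disj_coe [x]
  cases ω <;> simp [cmpTuple, h₁, h₂, List.range_succ]

section Tuples

variable {T T' : Type} {M : Semantics V T} {M' : Semantics V T'} {L : Lang}
  {S : Set (RelSym V)} {bs : List (RelSym V)} {U : Expr V} {Δ : Set (RelSym V)} {Γ : Set V.Name}

theorem represented_cmp (hU : Witnesses S bs U) (hM : M.DefinableIn M' L S bs) {ω : Op}
    {t t' : Term V} (h : CmpOK Γ ω t t') :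
    Represented M' L S bs Δ Γ fun _ η => some (M.cmp ω (t.eval η) (t'.eval η)) := by
  choose Φ hΦ hΦ' using fun τ => hM τ ω Γ t t' h
  refine ⟨fun τ => .not (.empty (.sel (Φ τ) U)), fun τ => ?_, fun D η hD τ => ?_⟩
  · exact ((hU.isExprIn L Δ Γ).sel ((hΦ τ).mono (Set.empty_subset _)
      Set.subset_union_left)).empty.not
  · obtain ⟨b, hb, hb'⟩ := hΦ' τ D η ⟨hD.isOver.mono (by simp), hD.nonempty, hD.typed⟩
    rw [hU.eval_not_empty_sel M' hD hb, hb']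
    rfl

variable [Finite T]

theorem represented_conj {ι : Type} (l : List ι) {f : ι → Env V → T}
    (h : ∀ i ∈ l, Represented M' L S bs Δ Γ fun _ η => some (f i η)) :
    Represented M' L S bs Δ Γ fun _ η => some (M.conj (l.map (fun i => f i η) : List T)) := by
  have : Nonempty T := ⟨M.tt⟩
  refine ((represented_foldr (g := fun _ _ => some ()) (f := fun i _ η _ => some (f i η))
    (Option.merge M.and) (represented_const none) l fun i hi => (h i hi).map some).map
      fun x => x.getD M.tt).congr fun D η _ => ?_
  simp [MVL.conj_coe, Function.comp_def]

theorem represented_disj {ι : Type} (l : List ι) {f : ι → Env V → T}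
    (h : ∀ i ∈ l, Represented M' L S bs Δ Γ fun _ η => some (f i η)) :
    Represented M' L S bs Δ Γ fun _ η => some (M.disj (l.map (fun i => f i η) : List T)) := by
  have : Nonempty T := ⟨M.tt⟩
  refine ((represented_foldr (g := fun _ _ => some ()) (f := fun i _ η _ => some (f i η))
    (Option.merge M.or) (represented_const none) l fun i hi => (h i hi).map some).map
      fun x => x.getD M.ff).congr fun D η _ => ?_
  simp [MVL.disj_coe, Function.comp_def]

theorem forall₂_mem_zip {α β : Type} {R : α → β → Prop} {l : List α} {l' : List β}
    (h : List.Forall₂ R l l') : ∀ p ∈ l.zip l', R p.1 p.2 :=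
  fun _ hp => (List.forall₂_iff_zip.1 h).2 hp

theorem represented_cmpTuple (hU : Witnesses S bs U) (hM : M.DefinableIn M' L S bs) {ω : Op}
    {ts ts' : List (Term V)} (h : List.Forall₂ (CmpOK Γ ω) ts ts') :
    Represented M' L S bs Δ Γ fun _ η =>
      some (M.cmpTuple ω (ts.map (Term.eval η)) (ts'.map (Term.eval η))) := by
  have hzip (ω' : Op) (η : Env V) :
      List.zipWith (M.cmp ω') (ts.map (Term.eval η)) (ts'.map (Term.eval η)) =
        (ts.zip ts').map fun p => M.cmp ω' (p.1.eval η) (p.2.eval η) := by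
    rw [List.zip, List.map_zipWith, List.zipWith_map]
  by_cases hω : ω.IsOrder
  · let items (i : ℕ) : List (Op × Term V × Term V) :=
      ((ts.zip ts').take i).map (fun p => (Op.eq, p)) ++
        [(if i + 1 = ts.length then ω else ω.strict, ts.getD i .null, ts'.getD i .null)]
    refine (represented_disj (M := M) (List.range ts.length) fun i hi =>
      represented_conj (M := M) (items i)
        (f := fun q η => M.cmp q.1 (q.2.1.eval η) (q.2.2.eval η))
        fun q hq => represented_cmp hU hM ?_).congr fun D η _ => ?_
    · rcases List.mem_append.1 hq with hq | hq
      · obtain ⟨p, hp, rfl⟩ := List.mem_map.1 hq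
        exact (forall₂_mem_zip h p (List.mem_of_mem_take hp)).eq
      · have hi : i < ts.length := List.mem_range.1 hi
        have hi' : i < ts'.length := h.length_eq ▸ hi
        obtain rfl := List.mem_singleton.1 hq
        have hc : CmpOK Γ ω (ts.getD i .null) (ts'.getD i .null) := by
          rw [List.getD_eq_getElem _ _ hi, List.getD_eq_getElem _ _ hi']
          exact h.get hi hi'
        dsimp only
        split
        exacts [hc, hc.strict]
    · rw [Semantics.cmpTuple_of_isOrder M hω, hzip]
      simp only [items, List.map_append, List.map_map, List.map_take, List.length_map,
        List.map_cons, List.map_nil, Function.comp_def]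
      have hget (l : List (Term V)) (i : ℕ) :
          (l.map (Term.eval η)).getD i Value.null = (l.getD i Term.null).eval η := by
        exact List.getD_map (f := Term.eval η) (d := Term.null) ..
      simp only [hget]
  · have h' (p : Term V × Term V) (hp : p ∈ ts.zip ts') : Represented M' L S bs Δ Γ fun _ η =>
        some (M.cmp ω (p.1.eval η) (p.2.eval η)) :=
      represented_cmp hU hM (forall₂_mem_zip h p hp)
    cases ω with
    | eq =>
      refine (represented_conj (M := M) _ h').congr fun D η _ => ?_
      rw [Semantics.cmpTuple, hzip]
    | ne =>
      refine (represented_disj (M := M) _ h').congr fun D η _ => ?_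
      rw [Semantics.cmpTuple, hzip]
    | _ => exact (hω trivial).elim

end Tuples

/-! ## Powers in finite monoids -/

/-- The class of a natural number with respect to a threshold and a period. -/
def natClass (N q : ℕ) (n : ℕ) : Fin N ⊕ Fin (q + 1) :=
  if h : n < N then .inl ⟨n, h⟩ else .inr ⟨n % (q + 1), Nat.mod_lt _ q.succ_pos⟩

theorem exists_pow_period (A : Type) [Monoid A] [Finite A] :
    ∃ N q : ℕ, 0 < N ∧ ∀ (x : A) (n : ℕ), N ≤ n → x ^ (n + (q + 1)) = x ^ n := by
  obtain ⟨m, n, hmn, h⟩ :=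
    Finite.exists_ne_map_eq_of_infinite fun n : ℕ => fun x : A => x ^ n
  wlog hlt : m < n generalizing m n
  · exact this n m hmn.symm h.symm (lt_of_le_of_ne (not_lt.1 hlt) hmn.symm)
  refine ⟨m + 1, n - m - 1, m.succ_pos, fun x k hk => ?_⟩
  replace hk := (Nat.le_succ m).trans hk
  obtain ⟨d, rfl⟩ := Nat.exists_eq_add_of_le hk
  have h' : m + d + (n - m - 1 + 1) = n + d := by omega
  have hx : x ^ m = x ^ n := congrFun h x
  rw [h', pow_add, pow_add, hx]

theorem exists_pow_eq_natClass (A : Type) [Monoid A] [Finite A] :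
    ∃ N q : ℕ, 0 < N ∧ ∀ x : A, ∃ g : Fin N ⊕ Fin (q + 1) → A, ∀ n, x ^ n = g (natClass N q n) := by
  obtain ⟨N, q, hN, h⟩ := exists_pow_period A
  have hk (x : A) (n : ℕ) (hn : N ≤ n) : ∀ k, x ^ (n + k * (q + 1)) = x ^ n := by
    intro k
    induction k with
    | zero => simp
    | succ k ih => rw [Nat.succ_mul, ← add_assoc, h x _ (by omega), ih]
  refine ⟨N, q, hN, fun x => ⟨Sum.elim (fun k => x ^ (k : ℕ))
    fun r => x ^ ((r : ℕ) + N * (q + 1)), fun n => ?_⟩⟩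
  unfold natClass
  split
  · rfl
  · rename_i hn
    have h₁ : N ≤ n % (q + 1) + N * (q + 1) :=
      (Nat.le_mul_of_pos_right N q.succ_pos).trans (Nat.le_add_left _ _)
    have h₂ : n % (q + 1) + N * (q + 1) + n / (q + 1) * (q + 1) = n + N * (q + 1) := by
      have := Nat.mod_add_div' n (q + 1)
      omega
    simp only [Sum.elim_inr]
    rw [← hk x n (not_lt.1 hn) N, ← h₂, hk x _ h₁]

/-- Partial combination by an associative and commutative operation, as a monoid. -/
@[reducible]
def mergeMonoid {T : Type} (op : T → T → T) [Std.Associative op] [Std.Commutative op] :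
    CommMonoid (Option T) where
  mul := Option.merge op
  one := none
  mul_assoc := Std.Associative.assoc (op := Option.merge op)
  mul_comm := Std.Commutative.comm (op := Option.merge op)
  one_mul x := by cases x <;> rfl
  mul_one x := by cases x <;> rfl

/-! ## Counting -/

/-- The semantics compares numerical values as usual. -/
def Semantics.StandardOnNum {T : Type} (M : Semantics V T) : Prop :=
  ∀ (ω : Op) (x y : V.Num), M.cmp ω (.num x) (.num y) = M.ofProp (ω.Holds x y)

/-- The number of records of `E`, as the value of the attribute `N` in a single record, if there
are records. -/
def Expr.count (E : Expr V) (F : V.Agg) (N : V.Name) : Expr V :=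
  .group [] [(F, N, N)] (.proj [(.num (V.nat 0), N)] E)

theorem Expr.eval_count {T : Type} (M : Semantics V T) {E : Expr V} {F : V.Agg}
    (hF : ∀ B : Multiset V.Num, V.agg F B = V.nat (Multiset.card B)) {N : V.Name}
    {D : Database V} {η : Env V} {B : Bag V} (hE : E.eval M D η = some B) :
    (E.count F N).eval M D η =
      some (if B = 0 then 0 else {[Value.num (V.nat (Multiset.card B))]}) := by
  simp only [Expr.count, Expr.eval, hE, Option.map_some, groupBag, Expr.attrs, List.map_cons,
    List.map_nil, Multiset.map_map, Function.comp_def, Term.eval, Env.extend, List.mem_singleton,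
    if_true, hF]
  by_cases hB : B = 0
  · simp [hB]
  · have hd : (B.map fun _ => ([] : Row V)).dedup = {[]} := by
      refine (Multiset.Nodup.ext (Multiset.nodup_dedup _) (Multiset.nodup_singleton _)).2 fun a => ?_
      obtain ⟨b, hb⟩ := Multiset.exists_mem_of_ne_zero hB
      simp only [Multiset.mem_dedup, Multiset.mem_map, Multiset.mem_singleton]
      exact ⟨fun ⟨_, _, h⟩ => h.symm, fun h => ⟨b, hb, h.symm⟩⟩
    have hm : (Multiset.filterMap (fun _ : Row V => some (V.nat 0)) B).card = B.card := by
      rw [← Multiset.card_map (fun _ => V.nat 0) B, ← Multiset.filterMap_eq_map]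
      rfl
    rw [hd, if_neg hB]
    simp [-Multiset.map_const', ← Multiset.filterMap_eq_map, Multiset.filterMap_filterMap, Value.num?, hm]

section Counting

variable {T : Type} {M : Semantics V T} {L : Lang} {S : Set (RelSym V)} {bs : List (RelSym V)}
  {Δ : Set (RelSym V)} {Γ : Set V.Name}

theorem exists_name (V : Vocab) (τ : Ty) : ∃ N, V.ty N = τ := (V.name_infinite τ).nonempty

theorem exists_cond_card (hcount : V.HasCount) {X : Expr V} (hX : L.IsExprIn S Δ Γ X)
    {N : V.Name} (hN : V.ty N = Ty.num) {Q : Cond V} {q : ℕ → Prop}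
    (hq : ¬q 0) (hQ : L.IsCondIn S Δ {N} Q)
    (hQ' : ∀ D η n, η N = Value.num (V.nat n) → Q.eval M D η = some (M.ofProp (q n))) :
    ∃ θ, L.IsCondIn S Δ Γ θ ∧ ∀ D η, θ.eval M D η =
      (X.eval M D η).map fun B => M.ofProp (q (Multiset.card B)) := by
  obtain ⟨F, hF⟩ := hcount
  refine ⟨.not (.empty (.sel Q (X.count F N))), ?_, fun D η => ?_⟩
  · refine (Lang.IsExprIn.sel ?_ (hQ.mono subset_rfl ?_)).empty.not
    · have := hX.proj (cols := [(.num (V.nat 0), N)]) (by simp) (by simp [Term.HasTy, hN])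
      simp only [Lang.IsExprIn, Expr.count, Expr.WF, Expr.NonRec] at this ⊢
      refine ⟨⟨this.1, ?_⟩, this.2⟩
      simp [Expr.attrs, hN]
    · simp [Expr.count, Expr.attrs]
  · cases hB : X.eval M D η with
    | none => simp [Cond.eval, Expr.count, Expr.eval, hB]
    | some B =>
      have := Expr.eval_sel_of_forall M (θ := Q) (f := fun _ => M.ofProp (q (Multiset.card B)))
        (Expr.eval_count M hF (N := N) hB) fun a ha => hQ' D _ _ ?_
      · simp only [Cond.eval, this, Option.map_some, MVL.neg_ofProp, MVL.ofProp_eq_tt]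
        by_cases h0 : B = 0 <;> by_cases hq' : q (Multiset.card B) <;> simp_all
      · split at ha
        · simp at ha
        · obtain rfl := Multiset.mem_singleton.1 ha
          simp [Env.extend, Expr.count, Expr.attrs]

theorem represented_natClass (hcount : V.HasCount) (hmod : V.HasMod) (hM : M.StandardOnNum)
    {X : Expr V} (hX : L.IsExprIn S Δ Γ X) {N : ℕ} (hN : 0 < N) (q : ℕ) :
    Represented M L S bs Δ Γ
      fun D η => (X.eval M D η).map fun B => natClass N q (Multiset.card B) := by
  obtain ⟨C, hC⟩ := exists_name V .num
  obtain ⟨f, hf, hf'⟩ := hmod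
  have hcmp (ω : Op) (t t' : Term V) (ht : t.HasTy {C} .num) (ht' : t'.HasTy {C} .num)
      (e e' : ℕ → ℕ)
      (h : ∀ n (η : Env V), η C = .num (V.nat n) →
        t.eval η = .num (V.nat (e n)) ∧ t'.eval η = .num (V.nat (e' n))) :
      L.IsCondIn S Δ {C} (.cmp [t] ω [t']) ∧ ∀ D η n, η C = Value.num (V.nat n) →
        (Cond.cmp [t] ω [t']).eval M D η = some (M.ofProp (ω.Holds (e n) (e' n))) := by
    refine ⟨isCondIn_cmp ⟨.num, ht, ht', fun _ => rfl⟩, fun D η n hn => ?_⟩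
    simp only [Cond.eval, List.map_cons, List.map_nil, Semantics.cmpTuple_singleton, h n η hn,
      hM ω]
    congr 2
    cases ω <;> simp [Op.Holds]
  have hC' : (Term.name C).HasTy {C} .num := ⟨rfl, hC⟩
  have key : ∀ c : Fin N ⊕ Fin (q + 1), ∃ θ, L.IsCondIn S Δ Γ θ ∧ ∀ D η, θ.eval M D η =
      (X.eval M D η).map fun B => M.ofProp (natClass N q (Multiset.card B) = c) := by
    rintro (⟨k, hk⟩ | ⟨r, hr⟩)
    · have hcl (n : ℕ) : natClass N q n = .inl ⟨k, hk⟩ ↔ n = k := by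
        unfold natClass
        split
        · simp
        · simp only [reduceCtorEq, false_iff]
          omega
      simp only [hcl]
      rcases Nat.eq_zero_or_pos k with rfl | hk0
      · exact ⟨.empty X, hX.empty, fun D η => by simp [Cond.eval]⟩
      · obtain ⟨h₁, h₂⟩ := hcmp .eq (.name C) (.num (V.nat k)) hC' rfl id (fun _ => k)
          fun n η hn => ⟨hn, rfl⟩
        exact exists_cond_card hcount hX hC hk0.ne h₁ h₂
    · have hcl (n : ℕ) : natClass N q n = .inr ⟨r, hr⟩ ↔ N ≤ n ∧ n % (q + 1) = r := by
        unfold natClass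
        split
        · simp only [reduceCtorEq, false_iff]
          omega
        · simp only [Sum.inr.injEq, Fin.mk.injEq]
          omega
      simp only [hcl]
      obtain ⟨h₁, h₂⟩ := hcmp .ge (.name C) (.num (V.nat N)) hC' rfl id (fun _ => N)
        fun n η hn => ⟨hn, rfl⟩
      obtain ⟨h₃, h₄⟩ := hcmp .eq
        (.app f fun i => ![.name C, .num (V.nat (q + 1))] (Fin.cast hf i)) (.num (V.nat r))
        ⟨rfl, fun i => by
          dsimp only
          generalize Fin.cast hf i = j
          fin_cases j
          exacts [hC', rfl]⟩ rfl (fun n => n % (q + 1)) (fun _ => r)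
        fun n η hn => by
          have he (i : Fin (V.arity f)) :
              (![Term.name C, .num (V.nat (q + 1))] (Fin.cast hf i)).eval η =
                .num (V.nat (![n, q + 1] (Fin.cast hf i))) := by
            generalize Fin.cast hf i = j
            fin_cases j
            exacts [hn, rfl]
          refine ⟨?_, rfl⟩
          simp only [Term.eval, he, Value.num?, Option.isSome_some, implies_true, dite_true,
            Option.get_some, hf' n (q + 1) q.succ_pos]
      exact exists_cond_card (q := fun n => N ≤ n ∧ n % (q + 1) = r) hcount hX hC
        (fun h => hN.not_ge h.1) (h₁.and h₃) fun D η n hn => by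
          have := h₂ D η n hn
          have := h₄ D η n hn
          simp_all only [Cond.eval, Option.bind_some, Option.map_some, Option.some.injEq,
            MVL.and_ofProp, Op.Holds, ge_iff_le, id]
  choose Φ hΦ hΦ' using key
  refine ⟨Φ, hΦ, fun D η _ c => ?_⟩
  rw [hΦ' c D η, Option.map_map]
  rfl

end Counting

/-! ## Renaming -/

theorem Term.exists_support (t : Term V) : ∃ s : Set V.Name, s.Finite ∧
    ∀ η η' : Env V, (∀ N ∈ s, η N = η' N) → t.eval η = t.eval η' := by
  induction t with
  | num | val | null => exact ⟨∅, Set.finite_empty, fun _ _ _ => rfl⟩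
  | name N => exact ⟨{N}, Set.finite_singleton N, fun _ _ h => h N rfl⟩
  | app f args ih =>
    choose s hs hs' using ih
    refine ⟨⋃ i, s i, Set.finite_iUnion hs, fun η η' h => ?_⟩
    have : ∀ i, (args i).eval η = (args i).eval η' :=
      fun i => hs' i η η' fun N hN => h N (Set.mem_iUnion_of_mem i hN)
    simp only [Term.eval, this]

theorem exists_support_list (ts : List (Term V)) : ∃ s : Set V.Name, s.Finite ∧
    ∀ η η' : Env V, (∀ N ∈ s, η N = η' N) → ts.map (Term.eval η) = ts.map (Term.eval η') := by
  induction ts with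
  | nil => exact ⟨∅, Set.finite_empty, fun _ _ _ => rfl⟩
  | cons t ts ih =>
    obtain ⟨s, hs, h⟩ := ih
    obtain ⟨s', hs', h'⟩ := t.exists_support
    refine ⟨s' ∪ s, hs'.union hs, fun η η' hη => ?_⟩
    rw [List.map_cons, List.map_cons, h' η η' fun N hN => hη N (Or.inl hN),
      h η η' fun N hN => hη N (Or.inr hN)]

theorem exists_fresh {s : Set V.Name} (hs : s.Finite) : ∀ Ns : List V.Name,
    ∃ Ns' : List V.Name, Ns'.Nodup ∧ Ns'.map V.ty = Ns.map V.ty ∧ ∀ N ∈ Ns', N ∉ s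
  | [] => ⟨[], List.nodup_nil, rfl, by simp⟩
  | N :: Ns => by
    obtain ⟨Ns', h₁, h₂, h₃⟩ := exists_fresh hs Ns
    obtain ⟨N', hN', hN''⟩ :=
      ((V.name_infinite (V.ty N)).sdiff (hs.union (List.finite_toSet Ns'))).nonempty
    simp only [Set.mem_union, not_or, Set.mem_ofPred_eq] at hN' hN''
    refine ⟨N' :: Ns', List.nodup_cons.2 ⟨hN''.2, h₁⟩, by simp [hN', h₂], fun M hM => ?_⟩
    rcases List.mem_cons.1 hM with rfl | hM
    exacts [hN''.1, h₃ M hM]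

/-- Replacement of the attribute names of an expression. -/
def Expr.rename (E : Expr V) (Ns : List V.Name) : Expr V :=
  .proj ((E.attrs.zip Ns).map fun p => (.name p.1, p.2)) E

theorem Expr.attrs_rename {E : Expr V} {Ns : List V.Name} (h : Ns.map V.ty = E.type) :
    (E.rename Ns).attrs = Ns := by
  have hl : Ns.length = E.attrs.length := by simpa [Expr.type] using congrArg List.length h
  simp only [rename, attrs, List.map_map]
  exact List.map_snd_zip hl.le

theorem Lang.IsExprIn.rename {L : Lang} {S Δ : Set (RelSym V)} {Γ : Set V.Name} {E : Expr V}
    (hE : L.IsExprIn S Δ Γ E) {Ns : List V.Name} (h : Ns.map V.ty = E.type) (hN : Ns.Nodup) :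
    L.IsExprIn S Δ Γ (E.rename Ns) := by
  refine hE.proj ?_ fun c hc => ?_
  · have := Expr.attrs_rename h
    simp only [Expr.rename, Expr.attrs] at this
    rwa [this]
  · obtain ⟨p, hp, rfl⟩ := List.mem_map.1 hc
    refine ⟨Or.inr (List.of_mem_zip hp).1, ?_⟩
    have : List.Forall₂ (fun N N' => V.ty N = V.ty N') E.attrs Ns := by
      have h' : List.Forall₂ Eq (E.attrs.map V.ty) (Ns.map V.ty) := by
        rw [h, List.forall₂_eq_eq_eq]
        rfl
      simpa only [List.forall₂_map_left_iff, List.forall₂_map_right_iff] using h'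
    exact forall₂_mem_zip this p hp

theorem Expr.eval_rename {T : Type} (M : Semantics V T) {S Δ : Set (RelSym V)} {Γ : Set V.Name}
    {E : Expr V} (hE : E.WF S Δ Γ) {Ns : List V.Name} (h : Ns.map V.ty = E.type)
    {D : Database V} {η : Env V} (hD : D.Over (S ∪ Δ)) (hη : η.Typed) :
    (E.rename Ns).eval M D η = E.eval M D η := by
  have hl : Ns.length = E.attrs.length := by simpa [Expr.type] using congrArg List.length h
  simp only [rename, Expr.eval]
  cases hB : E.eval M D η with
  | none => rfl
  | some B =>
    simp only [Option.map_some, List.map_map, Function.comp_def, Term.eval, Option.some.injEq]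
    conv_rhs => rw [← Multiset.map_id' B]
    refine Multiset.map_congr rfl fun a ha => ?_
    conv_rhs => rw [← Env.map_extend (η := η) hE.nodup_attrs
      (Expr.eval_typed M hE hD hη hB a ha).length_eq]
    conv_rhs => rw [← List.map_fst_zip hl.ge, List.map_map]
    rw [List.map_fst_zip hl.ge]
    rfl

/-! ## Comparisons with the records of a subquery -/

section Subquery

variable {T T' : Type} [Finite T] {M : Semantics V T} {M' : Semantics V T'} {L : Lang}
  {S : Set (RelSym V)} {bs : List (RelSym V)} {U : Expr V} {Δ : Set (RelSym V)} {Γ : Set V.Name}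

theorem exists_expr_filter_cmpTuple (hU : Witnesses S bs U) (hM : M.DefinableIn M' L S bs)
    {ω : Op} {ts : List (Term V)} {G : Expr V} (hG : L.IsExprIn S Δ Γ G)
    (hts : SubqueryOK Γ ω ts G.attrs) (τ : T) :
    ∃ X, L.IsExprIn S Δ Γ X ∧ ∀ D η, Admissible S Δ bs D η → X.eval M' D η =
      (G.eval M' D η).map fun B =>
        B.filter fun b => M.cmpTuple ω (ts.map (Term.eval η)) b = τ := by
  obtain ⟨s, hs, hs'⟩ := exists_support_list ts
  obtain ⟨Ns, hNs, hty, hfresh⟩ := exists_fresh hs G.attrs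
  have hattrs : (G.rename Ns).attrs = Ns := Expr.attrs_rename hty
  have hok : List.Forall₂ (CmpOK (Γ ∪ {N | N ∈ Ns}) ω) ts (Ns.map Term.name) := by
    rw [List.forall₂_map_right_iff]
    have h₁ : List.Forall₂ (fun t ν => t.HasTy Γ ν ∧ (ω.IsOrder → ν = .num)) ts (Ns.map V.ty) := by
      rw [hty, List.forall₂_map_right_iff]
      exact hts.2
    rw [List.forall₂_map_right_iff] at h₁
    refine List.forall₂_iff_get.2 ⟨h₁.length_eq, fun i hi hi' => ?_⟩
    obtain ⟨h₂, h₃⟩ := h₁.get hi hi'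
    exact ⟨_, h₂.mono Set.subset_union_left, ⟨Or.inr (List.getElem_mem hi'), rfl⟩, h₃⟩
  obtain ⟨Φ, hΦ, hΦ'⟩ := represented_cmpTuple (Δ := Δ) hU hM hok
  refine ⟨.sel (Φ τ) (G.rename Ns), (hG.rename hty hNs).sel (by rw [hattrs]; exact hΦ τ),
    fun D η hD => ?_⟩
  have hren := Expr.eval_rename M' hG.1 hty hD.isOver hD.typed
  cases hB : G.eval M' D η with
  | none => simp [Expr.eval, hren, hB]
  | some B =>
    rw [Expr.eval_sel_of_forall M' (hren.trans hB)
      (f := fun b => M'.ofProp (M.cmpTuple ω (ts.map (Term.eval η)) b = τ))]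
    · simp only [MVL.ofProp_eq_tt, Option.map_some]
    · intro b hb
      have hb' : RowTyped b Ns := (Expr.eval_typed M' hG.1 hD.isOver hD.typed hB b hb).congr hty.symm
      rw [hattrs, hΦ' D _ (hD.extend hb'), Option.map_some]
      rw [← hs' η (η.extend Ns b) fun N hN =>
        (if_neg fun h => hfresh N h hN).symm]
      rw [List.map_map]
      have : Ns.map (Term.eval (η.extend Ns b) ∘ Term.name) = b :=
        Env.map_extend hNs hb'.length_eq
      rw [this]

theorem represented_fold_cmpTuple (hcount : V.HasCount) (hmod : V.HasMod)
    (hM' : M'.StandardOnNum) (hU : Witnesses S bs U) (hM : M.DefinableIn M' L S bs)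
    {ω : Op} {ts : List (Term V)} {G : Expr V} (hG : L.IsExprIn S Δ Γ G)
    (hts : SubqueryOK Γ ω ts G.attrs) (op : T → T → T) [Std.Associative op]
    [Std.Commutative op] :
    Represented M' L S bs Δ Γ fun D η => (G.eval M' D η).map fun B =>
      ((B.map fun b => M.cmpTuple ω (ts.map (Term.eval η)) b).map some).fold
        (Option.merge op) none := by
  let := mergeMonoid op
  have := Fintype.ofFinite T
  have hT : Nonempty T := ⟨M.tt⟩
  choose X hX hX' using exists_expr_filter_cmpTuple (Δ := Δ) hU hM hG hts
  obtain ⟨N, q, hN, hpow⟩ := exists_pow_eq_natClass (Option T)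
  choose g hg using hpow
  have hne : Nonempty (Fin N ⊕ Fin (q + 1)) := ⟨.inr 0⟩
  have hcls (τ : T) (h : Fin N ⊕ Fin (q + 1) → Option T) :
      Represented M' L S bs Δ Γ fun D η => (G.eval M' D η).map fun B =>
        h (natClass N q ((B.map fun b => M.cmpTuple ω (ts.map (Term.eval η)) b).count τ)) := by
    refine ((represented_natClass hcount hmod hM' (hX τ) hN q).map h).congr fun D η hD => ?_
    simp only [hX' τ D η hD, Option.map_map, Function.comp_def, Multiset.count_map, eq_comm]
  refine (represented_foldr (Option.merge op) (hcls M.tt fun _ => none)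
    (Finset.univ.toList : List T) fun τ _ => hcls τ (g (some τ))).congr fun D η hD => ?_
  congr 1
  funext B
  generalize (B.map fun b => M.cmpTuple ω (ts.map (Term.eval η)) b) = C
  simp only [← hg]
  change (List.map (fun i => some i ^ C.count i) Finset.univ.toList).prod = _
  rw [Finset.prod_map_toList]
  have h₁ : (C.map some).fold (Option.merge op) none = (C.map some).prod := by
    rw [Multiset.prod_eq_foldr]
    rfl
  rw [h₁, Finset.prod_multiset_map_count]
  refine (Finset.prod_subset (Finset.subset_univ _) fun τ _ hτ => ?_).symm
  rw [Multiset.count_eq_zero.2 (by simpa using hτ), pow_zero]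

end Subquery

/-! ## Translation -/

/-- Relation symbols such that the value of the expression is empty if the relations are. -/
def Expr.bases : Expr V → List (RelSym V)
  | .rel R => [R]
  | .proj _ E => E.bases
  | .sel _ E => E.bases
  | .prod E₁ E₂ => E₁.bases ++ E₂.bases
  | .union E₁ E₂ => E₁.bases ++ E₂.bases
  | .inter E₁ E₂ => E₁.bases ++ E₂.bases
  | .diff E₁ E₂ => E₁.bases ++ E₂.bases
  | .dedup E => E.bases
  | .group _ _ E => E.bases
  | .mu _ _ E₁ _ => E₁.bases

theorem Expr.bases_ne_nil : ∀ E : Expr V, E.bases ≠ []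
  | .rel R => by simp [bases]
  | .proj _ E => by simpa [bases] using E.bases_ne_nil
  | .sel _ E => by simpa [bases] using E.bases_ne_nil
  | .prod E₁ E₂ => by simp [bases, E₁.bases_ne_nil]
  | .union E₁ E₂ => by simp [bases, E₁.bases_ne_nil]
  | .inter E₁ E₂ => by simp [bases, E₁.bases_ne_nil]
  | .diff E₁ E₂ => by simp [bases, E₁.bases_ne_nil]
  | .dedup E => by simpa [bases] using E.bases_ne_nil
  | .group _ _ E => by simpa [bases] using E.bases_ne_nil
  | .mu _ _ E₁ _ => by simpa [bases] using E₁.bases_ne_nil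

theorem Expr.WF.of_mem_bases {S : Set (RelSym V)} {Δ : Set (RelSym V)} {Γ : Set V.Name}
    {R : RelSym V} : ∀ {E : Expr V}, E.WF S Δ Γ → R ∈ E.bases → (R ∈ S ∨ R ∈ Δ) ∧ R.attrs.Nodup
  | .rel R, h, hR => by
    simp only [Expr.WF, bases, List.mem_singleton] at h hR
    exact hR ▸ h
  | .proj _ _, h, hR => by
    simp only [Expr.WF, bases] at h hR
    exact h.1.of_mem_bases hR
  | .sel _ _, h, hR => by
    simp only [Expr.WF, bases] at h hR
    exact h.1.of_mem_bases hR
  | .prod _ _, h, hR => by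
    simp only [Expr.WF, bases, List.mem_append] at h hR
    exact hR.elim h.1.of_mem_bases h.2.1.of_mem_bases
  | .union _ _, h, hR => by
    simp only [Expr.WF, bases, List.mem_append] at h hR
    exact hR.elim h.1.of_mem_bases h.2.1.of_mem_bases
  | .inter _ _, h, hR => by
    simp only [Expr.WF, bases, List.mem_append] at h hR
    exact hR.elim h.1.of_mem_bases h.2.1.of_mem_bases
  | .diff _ _, h, hR => by
    simp only [Expr.WF, bases, List.mem_append] at h hR
    exact hR.elim h.1.of_mem_bases h.2.1.of_mem_bases
  | .dedup _, h, hR => by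
    simp only [Expr.WF, bases] at h hR
    exact h.of_mem_bases hR
  | .group _ _ _, h, hR => by
    simp only [Expr.WF, bases] at h hR
    exact h.1.of_mem_bases hR
  | .mu _ _ _ _, h, hR => by
    simp only [Expr.WF, bases] at h hR
    exact h.2.1.of_mem_bases hR

theorem Expr.eval_eq_zero {T : Type} (M : Semantics V T) {D : Database V} {η : Env V} :
    ∀ {E : Expr V}, (∀ R ∈ E.bases, D R = 0) → E.eval M D η = some 0
  | .rel R, h => by
    simp only [Expr.eval, h R (by simp [bases])]
  | .proj _ E, h => by
    simp [Expr.eval, Expr.eval_eq_zero M (E := E) h]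
  | .sel _ E, h => by
    simp [Expr.eval, Expr.eval_eq_zero M (E := E) h]
  | .prod E₁ E₂, h => by
    simp only [bases, List.mem_append] at h
    simp [Expr.eval, Expr.eval_eq_zero M (E := E₁) fun R hR => h R (Or.inl hR),
      Expr.eval_eq_zero M (E := E₂) fun R hR => h R (Or.inr hR)]
  | .union E₁ E₂, h => by
    simp only [bases, List.mem_append] at h
    simp [Expr.eval, Expr.eval_eq_zero M (E := E₁) fun R hR => h R (Or.inl hR),
      Expr.eval_eq_zero M (E := E₂) fun R hR => h R (Or.inr hR)]
  | .inter E₁ E₂, h => by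
    simp only [bases, List.mem_append] at h
    simp [Expr.eval, Expr.eval_eq_zero M (E := E₁) fun R hR => h R (Or.inl hR),
      Expr.eval_eq_zero M (E := E₂) fun R hR => h R (Or.inr hR)]
  | .diff E₁ E₂, h => by
    simp only [bases, List.mem_append] at h
    simp [Expr.eval, Expr.eval_eq_zero M (E := E₁) fun R hR => h R (Or.inl hR),
      Expr.eval_eq_zero M (E := E₂) fun R hR => h R (Or.inr hR)]
  | .dedup E, h => by
    simp [Expr.eval, Expr.eval_eq_zero M (E := E) h]
  | .group _ _ E, h => by
    simp [Expr.eval, Expr.eval_eq_zero M (E := E) h, groupBag]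
  | .mu _ _ E₁ _, h => by
    simp [Expr.eval, Expr.eval_eq_zero M (E := E₁) h, recResult_zero]

/-- `G` translates `E` from the semantics `M` to the semantics `M'`. -/
structure Translates {T T' : Type} (M : Semantics V T) (M' : Semantics V T') (L : Lang)
    (S : Set (RelSym V)) (bs : List (RelSym V)) (Δ : Set (RelSym V)) (Γ : Set V.Name)
    (E G : Expr V) : Prop where
  isExprIn : L.IsExprIn S Δ Γ G
  attrs : G.attrs = E.attrs
  bases : G.bases = E.bases
  eval : ∀ D η, Admissible S Δ bs D η → E.eval M D η = G.eval M' D η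

section Translation

variable {T T' : Type} {M : Semantics V T} {M' : Semantics V T'} {L : Lang}
  {S : Set (RelSym V)} {bs : List (RelSym V)} {U : Expr V}

theorem Translates.type {Δ : Set (RelSym V)} {Γ : Set V.Name} {E G : Expr V}
    (h : Translates M M' L S bs Δ Γ E G) : G.type = E.type := by
  rw [Expr.type, h.attrs, Expr.type]

theorem Admissible.update {Δ : Set (RelSym V)} {D : Database V} {η : Env V}
    (h : Admissible S Δ bs D η) {R : RelSym V} (hR : R ∉ bs) {B : Bag V}
    (hB : ∀ a ∈ B, RowTyped a R.attrs) :
    Admissible S (insert R Δ) bs (Function.update D R B) η := by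
  refine ⟨h.isOver.update hB, ?_, h.typed⟩
  obtain ⟨R', hR', hD⟩ := h.nonempty
  exact ⟨R', hR', by rwa [Function.update_of_ne (ne_of_mem_of_not_mem hR' hR)]⟩

variable [Finite T]

theorem represented_quantifier (hcount : V.HasCount) (hmod : V.HasMod)
    (hM' : M'.StandardOnNum) (hU : Witnesses S bs U) (hM : M.DefinableIn M' L S bs)
    {Δ : Set (RelSym V)} {Γ : Set V.Name} {ω : Op} {ts : List (Term V)} {E G : Expr V}
    (hG : Translates M M' L S bs Δ Γ E G) (hts : SubqueryOK Γ ω ts E.attrs) (op : T → T → T)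
    [Std.Associative op] [Std.Commutative op] (e : T) :
    Represented M' L S bs Δ Γ fun D η => (E.eval M D η).map fun B =>
      (((B.map fun b => M.cmpTuple ω (ts.map (Term.eval η)) b).map some).fold
        (Option.merge op) none).getD e := by
  have : Nonempty T := ⟨M.tt⟩
  refine ((represented_fold_cmpTuple hcount hmod hM' hU hM hG.isExprIn (by rwa [hG.attrs])
    op).map fun x => x.getD e).congr fun D η hD => ?_
  rw [hG.eval D η hD, Option.map_map]
  rfl

mutual

theorem Expr.exists_translates (hcount : V.HasCount) (hmod : V.HasMod)
    (hM' : M'.StandardOnNum) (hU : Witnesses S bs U) (hM : M.DefinableIn M' L S bs)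
    (hbs : ∀ R ∈ bs, R ∈ S) : ∀ {E : Expr V} {Δ : Set (RelSym V)} {Γ : Set V.Name},
      L.IsExprIn S Δ Γ E → ∃ G, Translates M M' L S bs Δ Γ E G
  | .rel R, Δ, Γ, hE => ⟨.rel R, hE, rfl, rfl, fun D η _ => by simp [Expr.eval]⟩
  | .proj cols E, Δ, Γ, hE => by
    simp only [Lang.IsExprIn, Expr.WF, Expr.NonRec] at hE
    obtain ⟨G, hG⟩ := Expr.exists_translates hcount hmod hM' hU hM hbs ⟨hE.1.1, hE.2⟩
    refine ⟨.proj cols G, hG.isExprIn.proj hE.1.2.1 (by rw [hG.attrs]; exact hE.1.2.2), rfl,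
      by simp [Expr.bases, hG.bases], fun D η hD => ?_⟩
    simp only [Expr.eval, hG.eval D η hD, hG.attrs]
  | .sel θ E, Δ, Γ, hE => by
    simp only [Lang.IsExprIn, Expr.WF, Expr.NonRec] at hE
    obtain ⟨G, hG⟩ := Expr.exists_translates hcount hmod hM' hU hM hbs
      ⟨hE.1.1, fun hL => (hE.2 hL).2⟩
    obtain ⟨Φ, hΦ, hΦ'⟩ := Cond.represented hcount hmod hM' hU hM hbs (θ := θ)
      ⟨hE.1.2, fun hL => (hE.2 hL).1⟩
    refine ⟨.sel (Φ M.tt) G, hG.isExprIn.sel (by rw [hG.attrs]; exact hΦ _), hG.attrs,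
      by simp [Expr.bases, hG.bases], fun D η hD => ?_⟩
    simp only [Expr.eval, hG.eval D η hD, hG.attrs]
    refine Option.bind_congr fun B hB => ?_
    have key : ∀ a ∈ B, (Φ M.tt).eval M' D (η.extend E.attrs a) =
        (θ.eval M D (η.extend E.attrs a)).map fun x => M'.ofProp (x = M.tt) := fun a ha =>
      hΦ' D _ (hD.extend (hG.attrs ▸ Expr.eval_typed M' hG.isExprIn.1 hD.isOver hD.typed hB a ha)) _
    have h₁ : (∀ a ∈ B, (θ.eval M D (η.extend E.attrs a)).isSome) ↔
        ∀ a ∈ B, ((Φ M.tt).eval M' D (η.extend E.attrs a)).isSome :=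
      forall₂_congr fun a ha => by rw [key a ha, Option.isSome_map]
    simp only [h₁]
    congr 2
    refine Multiset.filter_congr fun a ha => ?_
    rw [key a ha]
    cases θ.eval M D (η.extend E.attrs a) <;> simp [MVL.ofProp_eq_tt]
  | .prod E₁ E₂, Δ, Γ, hE => by
    simp only [Lang.IsExprIn, Expr.WF, Expr.NonRec] at hE
    obtain ⟨G₁, h₁⟩ := Expr.exists_translates hcount hmod hM' hU hM hbs
      ⟨hE.1.1, fun hL => (hE.2 hL).1⟩
    obtain ⟨G₂, h₂⟩ := Expr.exists_translates hcount hmod hM' hU hM hbs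
      ⟨hE.1.2.1, fun hL => (hE.2 hL).2⟩
    refine ⟨.prod G₁ G₂, ?_, by simp [Expr.attrs, h₁.attrs, h₂.attrs],
      by simp [Expr.bases, h₁.bases, h₂.bases], fun D η hD => ?_⟩
    · simp only [Lang.IsExprIn, Expr.WF, Expr.NonRec, h₁.attrs, h₂.attrs]
      exact ⟨⟨h₁.isExprIn.1, h₂.isExprIn.1, hE.1.2.2⟩,
        fun hL => ⟨h₁.isExprIn.2 hL, h₂.isExprIn.2 hL⟩⟩
    · simp only [Expr.eval, h₁.eval D η hD, h₂.eval D η hD]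
  | .union E₁ E₂, Δ, Γ, hE => by
    simp only [Lang.IsExprIn, Expr.WF, Expr.NonRec] at hE
    obtain ⟨G₁, h₁⟩ := Expr.exists_translates hcount hmod hM' hU hM hbs
      ⟨hE.1.1, fun hL => (hE.2 hL).1⟩
    obtain ⟨G₂, h₂⟩ := Expr.exists_translates hcount hmod hM' hU hM hbs
      ⟨hE.1.2.1, fun hL => (hE.2 hL).2⟩
    refine ⟨.union G₁ G₂, ?_, by simp [Expr.attrs, h₁.attrs],
      by simp [Expr.bases, h₁.bases, h₂.bases], fun D η hD => ?_⟩
    · simp only [Lang.IsExprIn, Expr.WF, Expr.NonRec, h₁.type, h₂.type]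
      exact ⟨⟨h₁.isExprIn.1, h₂.isExprIn.1, hE.1.2.2⟩,
        fun hL => ⟨h₁.isExprIn.2 hL, h₂.isExprIn.2 hL⟩⟩
    · simp only [Expr.eval, h₁.eval D η hD, h₂.eval D η hD]
  | .inter E₁ E₂, Δ, Γ, hE => by
    simp only [Lang.IsExprIn, Expr.WF, Expr.NonRec] at hE
    obtain ⟨G₁, h₁⟩ := Expr.exists_translates hcount hmod hM' hU hM hbs
      ⟨hE.1.1, fun hL => (hE.2 hL).1⟩
    obtain ⟨G₂, h₂⟩ := Expr.exists_translates hcount hmod hM' hU hM hbs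
      ⟨hE.1.2.1, fun hL => (hE.2 hL).2⟩
    refine ⟨.inter G₁ G₂, ?_, by simp [Expr.attrs, h₁.attrs],
      by simp [Expr.bases, h₁.bases, h₂.bases], fun D η hD => ?_⟩
    · simp only [Lang.IsExprIn, Expr.WF, Expr.NonRec, h₁.type, h₂.type]
      exact ⟨⟨h₁.isExprIn.1, h₂.isExprIn.1, hE.1.2.2⟩,
        fun hL => ⟨h₁.isExprIn.2 hL, h₂.isExprIn.2 hL⟩⟩
    · simp only [Expr.eval, h₁.eval D η hD, h₂.eval D η hD]
  | .diff E₁ E₂, Δ, Γ, hE => by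
    simp only [Lang.IsExprIn, Expr.WF, Expr.NonRec] at hE
    obtain ⟨G₁, h₁⟩ := Expr.exists_translates hcount hmod hM' hU hM hbs
      ⟨hE.1.1, fun hL => (hE.2 hL).1⟩
    obtain ⟨G₂, h₂⟩ := Expr.exists_translates hcount hmod hM' hU hM hbs
      ⟨hE.1.2.1, fun hL => (hE.2 hL).2⟩
    refine ⟨.diff G₁ G₂, ?_, by simp [Expr.attrs, h₁.attrs],
      by simp [Expr.bases, h₁.bases, h₂.bases], fun D η hD => ?_⟩
    · simp only [Lang.IsExprIn, Expr.WF, Expr.NonRec, h₁.type, h₂.type]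
      exact ⟨⟨h₁.isExprIn.1, h₂.isExprIn.1, hE.1.2.2⟩,
        fun hL => ⟨h₁.isExprIn.2 hL, h₂.isExprIn.2 hL⟩⟩
    · simp only [Expr.eval, h₁.eval D η hD, h₂.eval D η hD]
  | .dedup E, Δ, Γ, hE => by
    simp only [Lang.IsExprIn, Expr.WF, Expr.NonRec] at hE
    obtain ⟨G, hG⟩ := Expr.exists_translates hcount hmod hM' hU hM hbs hE
    refine ⟨.dedup G, ?_, by simp [Expr.attrs, hG.attrs], by simp [Expr.bases, hG.bases],
      fun D η hD => ?_⟩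
    · simp only [Lang.IsExprIn, Expr.WF, Expr.NonRec]
      exact hG.isExprIn
    · simp only [Expr.eval, hG.eval D η hD]
  | .group keys aggs E, Δ, Γ, hE => by
    simp only [Lang.IsExprIn, Expr.WF, Expr.NonRec] at hE
    obtain ⟨G, hG⟩ := Expr.exists_translates hcount hmod hM' hU hM hbs ⟨hE.1.1, hE.2⟩
    refine ⟨.group keys aggs G, ?_, rfl, by simp [Expr.bases, hG.bases], fun D η hD => ?_⟩
    · simp only [Lang.IsExprIn, Expr.WF, Expr.NonRec, hG.attrs]
      exact ⟨⟨hG.isExprIn.1, hE.1.2⟩, hG.isExprIn.2⟩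
    · simp only [Expr.eval, hG.eval D η hD, hG.attrs]
  | .mu R distinct E₁ E₂, Δ, Γ, hE => by
    simp only [Lang.IsExprIn, Expr.WF, Expr.NonRec] at hE
    obtain ⟨⟨hR, hE₁, hE₂, hattrs, htype⟩, hrec⟩ := hE
    obtain ⟨G₁, h₁⟩ := Expr.exists_translates hcount hmod hM' hU hM hbs
      ⟨hE₁, fun hL => (hrec hL).elim⟩
    obtain ⟨G₂, h₂⟩ := Expr.exists_translates hcount hmod hM' hU hM hbs
      ⟨hE₂, fun hL => (hrec hL).elim⟩
    refine ⟨.mu R distinct G₁ G₂, ?_, rfl, by simp [Expr.bases, h₁.bases], fun D η hD => ?_⟩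
    · simp only [Lang.IsExprIn, Expr.WF, Expr.NonRec, h₁.attrs, h₂.type]
      exact ⟨⟨hR, h₁.isExprIn.1, h₂.isExprIn.1, hattrs, htype⟩, hrec⟩
    · simp only [Expr.eval, h₁.eval D η hD]
      refine Option.bind_congr fun B₀ hB₀ => ?_
      refine recResult_congr (p := fun a => RowTyped a R.attrs) ?_ ?_ fun B hB =>
        h₂.eval _ η (hD.update (fun h => hR (hbs R h)) hB)
      · rw [← hattrs, ← h₁.attrs]
        exact Expr.eval_typed M' h₁.isExprIn.1 hD.isOver hD.typed hB₀
      · exact fun B hB B' hB' a ha =>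
          (Expr.eval_typed M hE₂ (hD.isOver.update hB) hD.typed hB' a ha).congr htype

theorem Cond.represented (hcount : V.HasCount) (hmod : V.HasMod)
    (hM' : M'.StandardOnNum) (hU : Witnesses S bs U) (hM : M.DefinableIn M' L S bs)
    (hbs : ∀ R ∈ bs, R ∈ S) : ∀ {θ : Cond V} {Δ : Set (RelSym V)} {Γ : Set V.Name},
      L.IsCondIn S Δ Γ θ → Represented M' L S bs Δ Γ (θ.eval M)
  | .tt, Δ, Γ, _ => (represented_const M.tt).congr fun D η _ => by simp only [Cond.eval]
  | .ff, Δ, Γ, _ => (represented_const M.ff).congr fun D η _ => by simp only [Cond.eval]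
  | .isnull t, Δ, Γ, hθ => by
    have h : Represented M' L S bs Δ Γ fun _ η => some (t.eval η = Value.null) :=
      represented_of_cond hθ fun D η _ => by simp only [Cond.eval, Option.map_some]
    exact (h.map M.ofProp).congr fun D η _ => by simp only [Cond.eval, Option.map_some]
  | .cmp ts ω ts', Δ, Γ, hθ => by
    simp only [Lang.IsCondIn, Cond.WF] at hθ
    exact (represented_cmpTuple hU hM hθ.1.2).congr fun D η _ => by simp only [Cond.eval]
  | .mem ts E, Δ, Γ, hθ => by
    simp only [Lang.IsCondIn, Cond.WF, Cond.NonRec] at hθ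
    obtain ⟨G, hG⟩ := Expr.exists_translates hcount hmod hM' hU hM hbs ⟨hθ.1.1, hθ.2⟩
    exact (represented_quantifier hcount hmod hM' hU hM hG hθ.1.2 M.or M.ff).congr
      fun D η _ => by simp only [Cond.eval, MVL.disj]
  | .empty E, Δ, Γ, hθ => by
    simp only [Lang.IsCondIn, Cond.WF, Cond.NonRec] at hθ
    obtain ⟨G, hG⟩ := Expr.exists_translates hcount hmod hM' hU hM hbs hθ
    have h : Represented M' L S bs Δ Γ fun D η => (E.eval M D η).map fun B => B = 0 :=
      represented_of_cond hG.isExprIn.empty fun D η hD => by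
        simp only [Cond.eval, hG.eval D η hD, Option.map_map, Function.comp_def]
    exact (h.map M.ofProp).congr fun D η _ => by
      simp only [Cond.eval, Option.map_map, Function.comp_def]
  | .any ts ω E, Δ, Γ, hθ => by
    simp only [Lang.IsCondIn, Cond.WF, Cond.NonRec] at hθ
    obtain ⟨G, hG⟩ := Expr.exists_translates hcount hmod hM' hU hM hbs ⟨hθ.1.1, hθ.2⟩
    exact (represented_quantifier hcount hmod hM' hU hM hG hθ.1.2 M.or M.ff).congr
      fun D η _ => by simp only [Cond.eval, MVL.disj]
  | .all ts ω E, Δ, Γ, hθ => by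
    simp only [Lang.IsCondIn, Cond.WF, Cond.NonRec] at hθ
    obtain ⟨G, hG⟩ := Expr.exists_translates hcount hmod hM' hU hM hbs ⟨hθ.1.1, hθ.2⟩
    exact (represented_quantifier hcount hmod hM' hU hM hG hθ.1.2 M.and M.tt).congr
      fun D η _ => by simp only [Cond.eval, MVL.conj]
  | .or θ₁ θ₂, Δ, Γ, hθ => by
    simp only [Lang.IsCondIn, Cond.WF, Cond.NonRec] at hθ
    have : Nonempty T := ⟨M.tt⟩
    exact ((Cond.represented hcount hmod hM' hU hM hbs ⟨hθ.1.1, fun hL => (hθ.2 hL).1⟩).map₂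
      (Cond.represented hcount hmod hM' hU hM hbs ⟨hθ.1.2, fun hL => (hθ.2 hL).2⟩) M.or).congr
        fun D η _ => by simp only [Cond.eval]
  | .and θ₁ θ₂, Δ, Γ, hθ => by
    simp only [Lang.IsCondIn, Cond.WF, Cond.NonRec] at hθ
    have : Nonempty T := ⟨M.tt⟩
    exact ((Cond.represented hcount hmod hM' hU hM hbs ⟨hθ.1.1, fun hL => (hθ.2 hL).1⟩).map₂
      (Cond.represented hcount hmod hM' hU hM hbs ⟨hθ.1.2, fun hL => (hθ.2 hL).2⟩) M.and).congr
        fun D η _ => by simp only [Cond.eval]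
  | .not θ, Δ, Γ, hθ => by
    simp only [Lang.IsCondIn, Cond.WF, Cond.NonRec] at hθ
    have : Nonempty T := ⟨M.tt⟩
    exact ((Cond.represented hcount hmod hM' hU hM hbs hθ).map M.neg).congr
      fun D η _ => by simp only [Cond.eval]

end

theorem exists_expr_value_eq (hcount : V.HasCount) (hmod : V.HasMod) (hM' : M'.StandardOnNum)
    (hM : ∀ bs, bs ≠ [] → (∀ R ∈ bs, R ∈ S ∧ R.attrs.Nodup) → M.DefinableIn M' L S bs)
    {E : Expr V} (hE : L.IsExpr S E) :
    ∃ G : Expr V, L.IsExpr S G ∧ G.attrs = E.attrs ∧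
      ∀ D : Database V, D.Over S → E.value M D = G.value M' D := by
  have hbs : ∀ R ∈ E.bases, R ∈ S ∧ R.attrs.Nodup := fun R hR => by
    simpa using hE.1.of_mem_bases hR
  obtain ⟨U, hU⟩ := exists_witnesses E.bases_ne_nil hbs
  obtain ⟨G, hG⟩ := Expr.exists_translates hcount hmod hM' hU (hM _ E.bases_ne_nil hbs)
    (fun R hR => (hbs R hR).1) hE
  refine ⟨G, hG.isExprIn, hG.attrs, fun D hD => ?_⟩
  by_cases hne : ∃ R ∈ E.bases, D R ≠ 0
  · exact hG.eval D _ ⟨hD.mono (by simp), hne, Env.typed_empty⟩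
  · push Not at hne
    rw [Expr.value, Expr.value, Expr.eval_eq_zero M hne, Expr.eval_eq_zero M' (hG.bases ▸ hne)]

end Translation

/-! ## Definability of comparisons -/

/-- The values can be compared by `ω`, and neither of them is `NULL`. -/
def Comparable (ω : Op) (v v' : Value V) : Prop :=
  ∃ τ, v.HasTy τ ∧ v'.HasTy τ ∧ (ω.IsOrder → τ = Ty.num) ∧ v ≠ .null ∧ v' ≠ .null

theorem Comparable.eq {ω : Op} {v v' : Value V} (h : Comparable ω v v') : Comparable .eq v v' :=
  let ⟨τ, h₁, h₂, _, h₄⟩ := h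
  ⟨τ, h₁, h₂, False.elim, h₄⟩

theorem Comparable.strict {ω : Op} {v v' : Value V} (h : Comparable ω v v') :
    Comparable ω.strict v v' :=
  let ⟨τ, h₁, h₂, h₃, h₄⟩ := h
  ⟨τ, h₁, h₂, fun h => h₃ h.of_strict, h₄⟩

/-- Comparisons of values other than `NULL` have their usual truth value. -/
def Semantics.Standard {T : Type} (M : Semantics V T) : Prop :=
  ∀ (ω : Op) (v v' : Value V), Comparable ω v v' → M.cmp ω v v' = M.ofProp (ω.HoldsVal v v')

theorem sql_cmp_of_ne_null {ω : Op} {v v' : Value V} (h : v ≠ .null) (h' : v' ≠ .null) :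
    (sql V).cmp ω v v' = (sql V).ofProp (ω.HoldsVal v v') := by
  cases v <;> cases v' <;> first | rfl | exact absurd rfl h | exact absurd rfl h'

theorem sql_standard : (sql V).Standard :=
  fun _ _ _ ⟨_, _, _, _, h, h'⟩ => sql_cmp_of_ne_null h h'

theorem sql_cmp_of_null {ω : Op} {v v' : Value V} (h : v = .null ∨ v' = .null) :
    (sql V).cmp ω v v' = .u := by
  rcases h with rfl | rfl
  · rfl
  · cases v <;> rfl

theorem Semantics.Expressible.standard {T : Type} {M : Semantics V T} {L : Lang}
    {S : Set (RelSym V)} (hM : M.Expressible L S) : M.Standard := by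
  rintro ω v v' ⟨τ, h₁, h₂, h₃, h₄, h₅⟩
  cases v with
  | null => exact absurd rfl h₄
  | num x =>
    cases v' with
    | null => exact absurd rfl h₅
    | num y => exact hM.num_cmp ω x y
    | val d => exact absurd (h₁.symm.trans h₂) (by simp)
  | val c =>
    cases v' with
    | null => exact absurd rfl h₅
    | num y => exact absurd (h₁.symm.trans h₂) (by simp)
    | val d =>
      have hτ : τ ≠ .num := fun h => absurd (h₁.symm.trans h) (by simp)
      cases ω with
      | eq => simpa [Op.HoldsVal] using hM.val_eq c d
      | ne => simpa [Op.HoldsVal] using hM.val_ne c d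
      | _ => exact absurd (h₃ trivial) hτ

theorem Semantics.Standard.standardOnNum {T : Type} {M : Semantics V T} (h : M.Standard) :
    M.StandardOnNum := fun ω x y => h ω (.num x) (.num y) ⟨.num, rfl, rfl, fun _ => rfl, by simp⟩

theorem Semantics.Expressible.definableIn_sql {T : Type} {M : Semantics V T} {L : Lang}
    {S : Set (RelSym V)} (hM : M.Expressible L S) (bs : List (RelSym V)) :
    M.DefinableIn (sql V) L S bs := by
  intro τ ω Γ t t' h
  obtain ⟨θ, hθ, hθ'⟩ := hM.definable τ ω Γ t t' h
  exact ⟨θ, hθ, fun D η hD => hθ' D η (hD.isOver.mono Set.subset_union_left) hD.typed⟩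

theorem Witnesses.eval_not_empty_sel_sel {T : Type} (M : Semantics V T) {S Δ : Set (RelSym V)}
    {bs : List (RelSym V)} {U : Expr V} (hU : Witnesses S bs U) {D : Database V} {η : Env V}
    (h : Admissible S Δ bs D η) {θ θ' : Cond V} {b : T} {p : Prop}
    (hθ : θ.eval M D η = some (M.ofProp p)) (hθ' : θ'.eval M D η = some b) :
    (Cond.not (.empty (.sel θ' (.sel θ U)))).eval M D η = some (M.ofProp (p ∧ b = M.tt)) := by
  obtain ⟨B, hB, hne⟩ := hU.eval M D η
  have h₁ := Expr.eval_sel_of_forall M (θ := θ) (f := fun _ => M.ofProp p) hB fun a _ => by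
    rwa [hU.attrs, Env.extend_nil]
  have h₂ := Expr.eval_sel_of_forall M (θ := θ') (f := fun _ => b) h₁ fun a _ => by
    rwa [Expr.attrs, hU.attrs, Env.extend_nil]
  simp only [Cond.eval, h₂, Option.map_some, MVL.neg_ofProp, MVL.ofProp_eq_tt]
  by_cases hp : p <;> by_cases hb : b = M.tt <;> simp [hp, hb, hne h.nonempty]

theorem Semantics.Standard.definableIn {T : Type} {M : Semantics V T} (hM : M.Standard)
    {L : Lang} {S : Set (RelSym V)} {bs : List (RelSym V)} {U : Expr V}
    (hU : Witnesses S bs U) : (sql V).DefinableIn M L S bs := by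
  intro τ ω Γ t t' h
  obtain ⟨ty, ht, ht', hω⟩ := id h
  let isnn : Cond V := .and (.not (.isnull t)) (.not (.isnull t'))
  let C : Cond V := .not (.empty (.sel (.cmp [t] ω [t']) (.sel isnn U)))
  have hnn : L.IsCondIn S ∅ Γ isnn :=
    (isCondIn_isnull ht).not.and (isCondIn_isnull ht').not
  have hC : L.IsCondIn S ∅ Γ C :=
    (((hU.isExprIn L ∅ Γ).sel (hnn.mono subset_rfl Set.subset_union_left)).sel
      ((isCondIn_cmp h).mono subset_rfl Set.subset_union_left)).empty.not
  have enn (D : Database V) (η : Env V) : isnn.eval M D η =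
      some (M.ofProp (t.eval η ≠ .null ∧ t'.eval η ≠ .null)) := by
    simp only [isnn, Cond.eval, Option.map_some, Option.bind_some, MVL.neg_ofProp,
      MVL.and_ofProp, ne_eq]
  have eC (D : Database V) (η : Env V) (hD : Admissible S ∅ bs D η) : C.eval M D η =
      some (M.ofProp ((t.eval η ≠ .null ∧ t'.eval η ≠ .null) ∧
        ω.HoldsVal (t.eval η) (t'.eval η))) := by
    have hcmp : (Cond.cmp [t] ω [t']).eval M D η =
        some (M.cmp ω (t.eval η) (t'.eval η)) := by
      simp only [Cond.eval, List.map_cons, List.map_nil, Semantics.cmpTuple_singleton]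
    rw [hU.eval_not_empty_sel_sel M hD (enn D η) hcmp]
    congr 2
    refine propext (and_congr_right fun hne => ?_)
    rw [hM ω _ _ ⟨ty, Term.eval_hasTy hD.typed ht, Term.eval_hasTy hD.typed ht', hω, hne⟩,
      MVL.ofProp_eq_tt]
  have hsql (η : Env V) (hne : t.eval η ≠ .null ∧ t'.eval η ≠ .null) :
      (sql V).cmp ω (t.eval η) (t'.eval η) =
        if ω.HoldsVal (t.eval η) (t'.eval η) then K3.t else K3.f :=
    sql_cmp_of_ne_null hne.1 hne.2
  have hsql' (η : Env V) (hne : ¬(t.eval η ≠ .null ∧ t'.eval η ≠ .null)) :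
      (sql V).cmp ω (t.eval η) (t'.eval η) = K3.u :=
    sql_cmp_of_null (by tauto)
  cases τ with
  | t =>
    refine ⟨C, hC, fun D η hD => ⟨_, eC D η hD, ?_⟩⟩
    rw [MVL.ofProp_eq_tt]
    by_cases hne : t.eval η ≠ .null ∧ t'.eval η ≠ .null
    · rw [hsql η hne]
      split <;> simp_all
    · simp [hsql' η hne, hne]
  | f =>
    refine ⟨.and isnn (.not C), hnn.and hC.not, fun D η hD => ⟨_, (by
      simp only [Cond.eval, enn, eC D η hD, Option.bind_some, Option.map_some, MVL.neg_ofProp,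
        MVL.and_ofProp]
      rfl), ?_⟩⟩
    rw [MVL.ofProp_eq_tt]
    by_cases hne : t.eval η ≠ .null ∧ t'.eval η ≠ .null
    · rw [hsql η hne]
      split <;> simp_all
    · simp [hsql' η hne, hne]
  | u =>
    refine ⟨.not isnn, hnn.not, fun D η hD => ⟨_, (by
      simp only [Cond.eval, enn, Option.map_some, MVL.neg_ofProp]
      rfl), ?_⟩⟩
    rw [MVL.ofProp_eq_tt]
    by_cases hne : t.eval η ≠ .null ∧ t'.eval η ≠ .null
    · rw [hsql η hne]
      split <;> simp_all
    · simp [hsql' η hne, hne]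

instance : Finite K3 :=
  Finite.of_surjective (fun i : Fin 3 => match i with | 0 => K3.t | 1 => K3.f | 2 => K3.u) fun
    | .t => ⟨0, rfl⟩
    | .f => ⟨1, rfl⟩
    | .u => ⟨2, rfl⟩

/-! ## Databases without nulls -/

theorem Term.eval_ne_null {Γ : Set V.Name} {η : Env V} (hη : η.Typed)
    (hη' : ∀ N ∈ Γ, η N ≠ .null) {t : Term V} {τ : Ty} (ht : t.HasTy Γ τ) (hn : t.NoNull) :
    t.eval η ≠ .null := by
  induction t generalizing τ with
  | num | val => simp [Term.eval]
  | null => exact hn.elim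
  | name N => exact hη' N ht.1
  | app f args ih =>
    have : ∀ i, ((args i).eval η).num?.isSome := by
      intro i
      have h₁ := ih i (ht.2 i) (hn i)
      have h₂ := Term.eval_hasTy hη (ht.2 i)
      cases h : (args i).eval η with
      | num => rfl
      | val => rw [h] at h₂; cases h₂
      | null => exact absurd h h₁
    simp [Term.eval, this]

theorem Env.extend_ne_null {Γ : Set V.Name} {η : Env V} (hη : ∀ N ∈ Γ, η N ≠ .null)
    {Ns : List V.Name} {a : Row V} (ha : RowTyped a Ns) (ha' : Value.null ∉ a) :
    ∀ N ∈ Γ ∪ {N | N ∈ Ns}, η.extend Ns a N ≠ .null := by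
  intro N hN h
  rcases Env.extend_mem_or (η := η) ha.length_eq.symm N with ⟨_, h'⟩ | ⟨h', h''⟩
  · exact ha' (h ▸ h')
  · exact hη N (hN.resolve_right h') (h'' ▸ h)

/-- Typed data without nulls, where the environment has to be defined on `Γ` only. -/
structure NullFreeData (S Δ : Set (RelSym V)) (Γ : Set V.Name) (D : Database V) (η : Env V) :
    Prop where
  isOver : D.Over (S ∪ Δ)
  nullFree : D.NullFree (S ∪ Δ)
  typed : η.Typed
  ne_null : ∀ N ∈ Γ, η N ≠ .null

section NullFree

variable {S Δ : Set (RelSym V)} {Γ : Set V.Name} {D : Database V} {η : Env V}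

theorem NullFreeData.extend (h : NullFreeData S Δ Γ D η) {Ns : List V.Name} {a : Row V}
    (ha : RowTyped a Ns) (ha' : Value.null ∉ a) :
    NullFreeData S Δ (Γ ∪ {N | N ∈ Ns}) D (η.extend Ns a) :=
  ⟨h.isOver, h.nullFree, h.typed.extend ha, Env.extend_ne_null h.ne_null ha ha'⟩

theorem NullFreeData.update (h : NullFreeData S Δ Γ D η) {R : RelSym V} {B : Bag V}
    (hB : ∀ a ∈ B, RowTyped a R.attrs ∧ Value.null ∉ a) :
    NullFreeData S (insert R Δ) Γ (Function.update D R B) η := by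
  refine ⟨h.isOver.update fun a ha => (hB a ha).1, fun R' hR' a ha => ?_, h.typed, h.ne_null⟩
  by_cases hR : R' = R
  · subst hR
    exact (hB a (by simpa using ha)).2
  · rw [Function.update_of_ne hR] at ha
    refine h.nullFree R' ?_ a ha
    rcases hR' with h' | h' | h'
    exacts [Or.inl h', absurd h' hR, Or.inr h']

theorem Expr.null_notMem {T : Type} (M : Semantics V T) :
    ∀ {E : Expr V} {Δ : Set (RelSym V)} {D : Database V} {B : Bag V},
      E.WF S Δ Γ → E.NoNull → NullFreeData S Δ Γ D η → E.eval M D η = some B →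
        ∀ a ∈ B, Value.null ∉ a
  | .rel R, _, _, _, hE, _, hD, h => by
    simp only [Expr.WF, Expr.eval, Option.some.injEq] at hE h
    subst h
    exact hD.nullFree R hE.1
  | .proj cols E, _, _, _, hE, hn, hD, h => by
    simp only [Expr.WF, Expr.NoNull, Expr.eval, Option.map_eq_some_iff] at hE hn h
    obtain ⟨B, hB, rfl⟩ := h
    intro a ha h0
    obtain ⟨b, hb, rfl⟩ := Multiset.mem_map.1 ha
    obtain ⟨c, hc, h0⟩ := List.mem_map.1 h0
    have hD' := hD.extend (Expr.eval_typed M hE.1 hD.isOver hD.typed hB b hb)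
      (Expr.null_notMem M hE.1 hn.2 hD hB b hb)
    exact Term.eval_ne_null hD'.typed hD'.ne_null (hE.2.2 c hc) (hn.1 c hc) h0
  | .sel θ E, _, _, _, hE, hn, hD, h => by
    simp only [Expr.WF, Expr.NoNull, Expr.eval, Option.bind_eq_some_iff] at hE hn h
    obtain ⟨B, hB, h⟩ := h
    split at h
    · obtain rfl := Option.some.inj h
      exact fun a ha => Expr.null_notMem M hE.1 hn.2 hD hB a (Multiset.mem_filter.1 ha).1
    · simp at h
  | .prod E₁ E₂, _, _, _, hE, hn, hD, h => by
    simp only [Expr.WF, Expr.NoNull, Expr.eval, Option.bind_eq_some_iff,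
      Option.map_eq_some_iff] at hE hn h
    obtain ⟨B₁, hB₁, B₂, hB₂, rfl⟩ := h
    intro a ha
    simp only [Multiset.mem_bind, Multiset.mem_map] at ha
    obtain ⟨b, hb, c, hc, rfl⟩ := ha
    rw [List.mem_append, not_or]
    exact ⟨Expr.null_notMem M hE.1 hn.1 hD hB₁ b hb, Expr.null_notMem M hE.2.1 hn.2 hD hB₂ c hc⟩
  | .union E₁ E₂, _, _, _, hE, hn, hD, h => by
    simp only [Expr.WF, Expr.NoNull, Expr.eval, Option.bind_eq_some_iff,
      Option.map_eq_some_iff] at hE hn h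
    obtain ⟨B₁, hB₁, B₂, hB₂, rfl⟩ := h
    intro a ha
    rcases Multiset.mem_add.1 ha with ha | ha
    · exact Expr.null_notMem M hE.1 hn.1 hD hB₁ a ha
    · exact Expr.null_notMem M hE.2.1 hn.2 hD hB₂ a ha
  | .inter E₁ E₂, _, _, _, hE, hn, hD, h => by
    simp only [Expr.WF, Expr.NoNull, Expr.eval, Option.bind_eq_some_iff,
      Option.map_eq_some_iff] at hE hn h
    obtain ⟨B₁, hB₁, B₂, hB₂, rfl⟩ := h
    exact fun a ha => Expr.null_notMem M hE.1 hn.1 hD hB₁ a (Multiset.mem_inter.1 ha).1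
  | .diff E₁ E₂, _, _, _, hE, hn, hD, h => by
    simp only [Expr.WF, Expr.NoNull, Expr.eval, Option.bind_eq_some_iff,
      Option.map_eq_some_iff] at hE hn h
    obtain ⟨B₁, hB₁, B₂, hB₂, rfl⟩ := h
    exact fun a ha => Expr.null_notMem M hE.1 hn.1 hD hB₁ a
      (Multiset.mem_of_le (Multiset.sub_le_self _ _) ha)
  | .dedup E, _, _, _, hE, hn, hD, h => by
    simp only [Expr.WF, Expr.NoNull, Expr.eval, Option.map_eq_some_iff] at hE hn h
    obtain ⟨B, hB, rfl⟩ := h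
    exact fun a ha => Expr.null_notMem M hE hn hD hB a (Multiset.mem_dedup.1 ha)
  | .group keys aggs E, _, _, _, hE, hn, hD, h => by
    simp only [Expr.WF, Expr.NoNull, Expr.eval, Option.map_eq_some_iff] at hE hn h
    obtain ⟨B, hB, rfl⟩ := h
    intro a ha
    simp only [groupBag, Multiset.mem_map, Multiset.mem_dedup] at ha
    obtain ⟨_, ⟨b, hb, rfl⟩, rfl⟩ := ha
    have hD' := hD.extend (Expr.eval_typed M hE.1 hD.isOver hD.typed hB b hb)
      (Expr.null_notMem M hE.1 hn hD hB b hb)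
    simp only [List.mem_append, List.mem_map, not_or, not_exists, not_and]
    exact ⟨fun N hN => hD'.ne_null N (Or.inr (hE.2.2.1 N hN)), fun c _ => by simp⟩
  | .mu R distinct E₁ E₂, _, _, _, hE, hn, hD, h => by
    simp only [Expr.WF, Expr.NoNull, Expr.eval, Option.bind_eq_some_iff] at hE hn h
    obtain ⟨B₀, hB₀, h⟩ := h
    refine fun a ha =>
      (recResult_forall (p := fun a => RowTyped a R.attrs ∧ Value.null ∉ a) ?_ ?_ h a ha).2
    · exact fun a ha => ⟨hE.2.2.2.1 ▸ Expr.eval_typed M hE.2.1 hD.isOver hD.typed hB₀ a ha,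
        Expr.null_notMem M hE.2.1 hn.1 hD hB₀ a ha⟩
    · intro B hB B' hB' a ha
      have hD' := hD.update hB
      exact ⟨(Expr.eval_typed M hE.2.2.1 hD'.isOver hD'.typed hB' a ha).congr hE.2.2.2.2,
        Expr.null_notMem M hE.2.2.1 hn.2 hD' hB' a ha⟩

end NullFree

/-- The two truth values are the same Boolean value. -/
def SameBool {T T' : Type} (M : MVL T) (M' : MVL T') (x : T) (y : T') : Prop :=
  ∃ p : Prop, x = M.ofProp p ∧ y = M'.ofProp p

section SameBool

variable {T T' : Type} {M : MVL T} {M' : MVL T'}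

theorem SameBool.neg {x : T} {y : T'} (h : SameBool M M' x y) :
    SameBool M M' (M.neg x) (M'.neg y) := by
  obtain ⟨p, rfl, rfl⟩ := h
  exact ⟨¬p, M.neg_ofProp p, M'.neg_ofProp p⟩

theorem SameBool.and {x x' : T} {y y' : T'} (h : SameBool M M' x y) (h' : SameBool M M' x' y') :
    SameBool M M' (M.and x x') (M'.and y y') := by
  obtain ⟨p, rfl, rfl⟩ := h
  obtain ⟨q, rfl, rfl⟩ := h'
  exact ⟨p ∧ q, M.and_ofProp p q, M'.and_ofProp p q⟩

theorem SameBool.or {x x' : T} {y y' : T'} (h : SameBool M M' x y) (h' : SameBool M M' x' y') :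
    SameBool M M' (M.or x x') (M'.or y y') := by
  obtain ⟨p, rfl, rfl⟩ := h
  obtain ⟨q, rfl, rfl⟩ := h'
  exact ⟨p ∨ q, M.or_ofProp p q, M'.or_ofProp p q⟩

theorem sameBool_tt : SameBool M M' M.tt M'.tt := ⟨True, M.ofProp_true.symm, M'.ofProp_true.symm⟩

theorem sameBool_ff : SameBool M M' M.ff M'.ff :=
  ⟨False, M.ofProp_false.symm, M'.ofProp_false.symm⟩

theorem SameBool.eq_tt_iff {x : T} {y : T'} (h : SameBool M M' x y) : x = M.tt ↔ y = M'.tt := by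
  obtain ⟨p, rfl, rfl⟩ := h
  rw [MVL.ofProp_eq_tt, MVL.ofProp_eq_tt]

theorem rel_foldr_merge {op : T → T → T} {op' : T' → T' → T'}
    (hop : ∀ x x' y y', SameBool M M' x y → SameBool M M' x' y' →
      SameBool M M' (op x x') (op' y y')) {l : List T} {l' : List T'}
    (h : List.Forall₂ (SameBool M M') l l') :
    Option.Rel (SameBool M M') ((l.map some).foldr (Option.merge op) none)
      ((l'.map some).foldr (Option.merge op') none) := by
  induction h with
  | nil => exact .none
  | cons h₁ _ ih =>
    simp only [List.map_cons, List.foldr_cons]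
    generalize List.foldr (Option.merge op) none _ = z at ih ⊢
    generalize List.foldr (Option.merge op') none _ = z' at ih ⊢
    cases ih with
    | none => exact .some h₁
    | some h₂ => exact .some (hop _ _ _ _ h₁ h₂)

theorem rel_getD {R : T → T' → Prop} {x : Option T} {y : Option T'} (h : Option.Rel R x y)
    {d : T} {d' : T'} (hd : R d d') : R (x.getD d) (y.getD d') := by
  cases h with
  | none => exact hd
  | some h => exact h

theorem sameBool_conj {l : List T} {l' : List T'} (h : List.Forall₂ (SameBool M M') l l') :
    SameBool M M' (M.conj l) (M'.conj l') := by
  rw [MVL.conj_coe, MVL.conj_coe]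
  exact rel_getD (rel_foldr_merge (fun _ _ _ _ h h' => h.and h') h) sameBool_tt

theorem sameBool_disj {l : List T} {l' : List T'} (h : List.Forall₂ (SameBool M M') l l') :
    SameBool M M' (M.disj l) (M'.disj l') := by
  rw [MVL.disj_coe, MVL.disj_coe]
  exact rel_getD (rel_foldr_merge (fun _ _ _ _ h h' => h.or h') h) sameBool_ff

theorem sameBool_conj_map {α : Type} {B : Multiset α} {f : α → T} {f' : α → T'}
    (h : ∀ a ∈ B, SameBool M M' (f a) (f' a)) :
    SameBool M M' (M.conj (B.map f)) (M'.conj (B.map f')) := by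
  induction B using Quotient.inductionOn with
  | h l =>
    refine sameBool_conj ?_
    rw [List.forall₂_map_left_iff, List.forall₂_map_right_iff, List.forall₂_same]
    exact h

theorem sameBool_disj_map {α : Type} {B : Multiset α} {f : α → T} {f' : α → T'}
    (h : ∀ a ∈ B, SameBool M M' (f a) (f' a)) :
    SameBool M M' (M.disj (B.map f)) (M'.disj (B.map f')) := by
  induction B using Quotient.inductionOn with
  | h l =>
    refine sameBool_disj ?_
    rw [List.forall₂_map_left_iff, List.forall₂_map_right_iff, List.forall₂_same]
    exact h

end SameBool

section Agreement

variable {T T' : Type} {M : Semantics V T} {M' : Semantics V T'}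

theorem sameBool_cmp (hM : M.Standard) (hM' : M'.Standard) {ω : Op} {v v' : Value V}
    (h : Comparable ω v v') : SameBool M.toMVL M'.toMVL (M.cmp ω v v') (M'.cmp ω v v') :=
  ⟨_, hM ω v v' h, hM' ω v v' h⟩

theorem sameBool_cmpTuple (hM : M.Standard) (hM' : M'.Standard) {ω : Op} {a b : Row V}
    (h : List.Forall₂ (Comparable ω) a b) :
    SameBool M.toMVL M'.toMVL (M.cmpTuple ω a b) (M'.cmpTuple ω a b) := by
  have hzip (ω' : Op) (h' : ∀ v v' : Value V, Comparable ω v v' → Comparable ω' v v') :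
      List.Forall₂ (SameBool M.toMVL M'.toMVL) (List.zipWith (M.cmp ω') a b)
        (List.zipWith (M'.cmp ω') a b) := by
    induction h with
    | nil => exact .nil
    | cons h₁ _ ih => exact .cons (sameBool_cmp hM hM' (h' _ _ h₁)) ih
  by_cases hω : ω.IsOrder
  · rw [M.cmpTuple_of_isOrder hω, M'.cmpTuple_of_isOrder hω]
    refine sameBool_disj ?_
    simp only [List.forall₂_map_left_iff, List.forall₂_map_right_iff, List.forall₂_same]
    intro i hi
    refine sameBool_conj (List.rel_append (List.forall₂_take i
      (hzip .eq fun _ _ h => h.eq)) (.cons ?_ .nil))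
    have hi : i < a.length := List.mem_range.1 hi
    have hi' : i < b.length := h.length_eq ▸ hi
    rw [List.getD_eq_getElem _ _ hi, List.getD_eq_getElem _ _ hi']
    have hc : Comparable ω a[i] b[i] := h.get hi hi'
    split
    exacts [sameBool_cmp hM hM' hc, sameBool_cmp hM hM' hc.strict]
  · cases ω with
    | eq => exact sameBool_conj (hzip .eq fun _ _ h => h)
    | ne => exact sameBool_disj (hzip .ne fun _ _ h => h)
    | _ => exact (hω trivial).elim

variable {S : Set (RelSym V)}

theorem comparable_row {Δ : Set (RelSym V)} {Γ : Set V.Name} {D : Database V} {η : Env V}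
    (hD : NullFreeData S Δ Γ D η) {ω : Op} {ts : List (Term V)} {Ns : List V.Name}
    (hts : SubqueryOK Γ ω ts Ns) (hn : ∀ t ∈ ts, t.NoNull) {b : Row V} (hb : RowTyped b Ns)
    (hb' : Value.null ∉ b) : List.Forall₂ (Comparable ω) (ts.map (Term.eval η)) b := by
  rw [List.forall₂_map_left_iff]
  refine List.forall₂_iff_get.2 ⟨hts.2.length_eq.trans hb.length_eq.symm, fun i hi hi' => ?_⟩
  have hi'' : i < Ns.length := hts.2.length_eq ▸ hi
  obtain ⟨h₁, h₂⟩ := hts.2.get hi hi''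
  exact ⟨_, Term.eval_hasTy hD.typed h₁, hb.get hi' hi'', h₂,
    Term.eval_ne_null hD.typed hD.ne_null h₁ (hn _ (List.getElem_mem hi)),
    fun h => hb' (h ▸ List.getElem_mem hi')⟩

theorem rel_map {α : Type} {x : Option α} {R : T → T' → Prop} {f : α → T} {f' : α → T'}
    (h : ∀ a, x = some a → R (f a) (f' a)) : Option.Rel R (x.map f) (x.map f') := by
  cases x with
  | none => exact .none
  | some a => exact .some (h a rfl)

mutual

theorem Expr.eval_eq_of_nullFree (hM : M.Standard) (hM' : M'.Standard) :
    ∀ {E : Expr V} {Δ : Set (RelSym V)} {Γ : Set V.Name} {D : Database V} {η : Env V},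
      E.WF S Δ Γ → E.NoNull → NullFreeData S Δ Γ D η → E.eval M D η = E.eval M' D η
  | .rel R, _, _, _, _, _, _, _ => by simp only [Expr.eval]
  | .proj cols E, _, _, _, _, hE, hn, hD => by
    simp only [Expr.WF, Expr.NoNull] at hE hn
    simp only [Expr.eval, Expr.eval_eq_of_nullFree hM hM' hE.1 hn.2 hD]
  | .sel θ E, _, _, D, η, hE, hn, hD => by
    simp only [Expr.WF, Expr.NoNull] at hE hn
    simp only [Expr.eval, Expr.eval_eq_of_nullFree hM hM' hE.1 hn.2 hD]
    refine Option.bind_congr fun B hB => ?_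
    have key : ∀ a ∈ B, Option.Rel (SameBool M.toMVL M'.toMVL)
        (θ.eval M D (η.extend E.attrs a)) (θ.eval M' D (η.extend E.attrs a)) := fun a ha =>
      Cond.sameBool_of_nullFree hM hM' hE.2 hn.1 (hD.extend
        (Expr.eval_typed M' hE.1 hD.isOver hD.typed hB a ha)
        (Expr.null_notMem M' hE.1 hn.2 hD hB a ha))
    have h₁ : (∀ a ∈ B, (θ.eval M D (η.extend E.attrs a)).isSome) ↔
        ∀ a ∈ B, (θ.eval M' D (η.extend E.attrs a)).isSome := by
      refine forall₂_congr fun a ha => ?_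
      have := key a ha
      generalize θ.eval M D (η.extend E.attrs a) = x at this ⊢
      generalize θ.eval M' D (η.extend E.attrs a) = y at this ⊢
      cases this <;> simp
    simp only [h₁]
    congr 2
    refine Multiset.filter_congr fun a ha => ?_
    have := key a ha
    generalize θ.eval M D (η.extend E.attrs a) = x at this ⊢
    generalize θ.eval M' D (η.extend E.attrs a) = y at this ⊢
    cases this with
    | none => simp
    | some h => simpa using h.eq_tt_iff
  | .prod E₁ E₂, _, _, _, _, hE, hn, hD => by
    simp only [Expr.WF, Expr.NoNull] at hE hn
    simp only [Expr.eval, Expr.eval_eq_of_nullFree hM hM' hE.1 hn.1 hD,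
      Expr.eval_eq_of_nullFree hM hM' hE.2.1 hn.2 hD]
  | .union E₁ E₂, _, _, _, _, hE, hn, hD => by
    simp only [Expr.WF, Expr.NoNull] at hE hn
    simp only [Expr.eval, Expr.eval_eq_of_nullFree hM hM' hE.1 hn.1 hD,
      Expr.eval_eq_of_nullFree hM hM' hE.2.1 hn.2 hD]
  | .inter E₁ E₂, _, _, _, _, hE, hn, hD => by
    simp only [Expr.WF, Expr.NoNull] at hE hn
    simp only [Expr.eval, Expr.eval_eq_of_nullFree hM hM' hE.1 hn.1 hD,
      Expr.eval_eq_of_nullFree hM hM' hE.2.1 hn.2 hD]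
  | .diff E₁ E₂, _, _, _, _, hE, hn, hD => by
    simp only [Expr.WF, Expr.NoNull] at hE hn
    simp only [Expr.eval, Expr.eval_eq_of_nullFree hM hM' hE.1 hn.1 hD,
      Expr.eval_eq_of_nullFree hM hM' hE.2.1 hn.2 hD]
  | .dedup E, _, _, _, _, hE, hn, hD => by
    simp only [Expr.WF, Expr.NoNull] at hE hn
    simp only [Expr.eval, Expr.eval_eq_of_nullFree hM hM' hE hn hD]
  | .group keys aggs E, _, _, _, _, hE, hn, hD => by
    simp only [Expr.WF, Expr.NoNull] at hE hn
    simp only [Expr.eval, Expr.eval_eq_of_nullFree hM hM' hE.1 hn hD]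
  | .mu R distinct E₁ E₂, _, _, _, _, hE, hn, hD => by
    simp only [Expr.WF, Expr.NoNull] at hE hn
    simp only [Expr.eval, Expr.eval_eq_of_nullFree hM hM' hE.2.1 hn.1 hD]
    refine Option.bind_congr fun B₀ hB₀ => ?_
    refine recResult_congr (p := fun a => RowTyped a R.attrs ∧ Value.null ∉ a) ?_ ?_ fun B hB =>
      Expr.eval_eq_of_nullFree hM hM' hE.2.2.1 hn.2 (hD.update hB)
    · exact fun a ha => ⟨hE.2.2.2.1 ▸ Expr.eval_typed M' hE.2.1 hD.isOver hD.typed hB₀ a ha,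
        Expr.null_notMem M' hE.2.1 hn.1 hD hB₀ a ha⟩
    · intro B hB B' hB' a ha
      have hD' := hD.update hB
      exact ⟨(Expr.eval_typed M hE.2.2.1 hD'.isOver hD'.typed hB' a ha).congr hE.2.2.2.2,
        Expr.null_notMem M hE.2.2.1 hn.2 hD' hB' a ha⟩

theorem Cond.sameBool_of_nullFree (hM : M.Standard) (hM' : M'.Standard) :
    ∀ {θ : Cond V} {Δ : Set (RelSym V)} {Γ : Set V.Name} {D : Database V} {η : Env V},
      θ.WF S Δ Γ → θ.NoNull → NullFreeData S Δ Γ D η →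
        Option.Rel (SameBool M.toMVL M'.toMVL) (θ.eval M D η) (θ.eval M' D η)
  | .tt, _, _, _, _, _, _, _ => by
    simp only [Cond.eval]
    exact .some sameBool_tt
  | .ff, _, _, _, _, _, _, _ => by
    simp only [Cond.eval]
    exact .some sameBool_ff
  | .isnull t, _, _, _, _, _, _, _ => by
    simp only [Cond.eval]
    exact .some ⟨_, rfl, rfl⟩
  | .cmp ts ω ts', _, _, _, _, hθ, hn, hD => by
    simp only [Cond.WF, Cond.NoNull, Cond.eval] at hθ hn ⊢
    refine .some (sameBool_cmpTuple hM hM' ?_)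
    rw [List.forall₂_map_left_iff, List.forall₂_map_right_iff]
    refine List.forall₂_iff_get.2 ⟨hθ.2.length_eq, fun i hi hi' => ?_⟩
    obtain ⟨τ, h₁, h₂, h₃⟩ := hθ.2.get hi hi'
    exact ⟨τ, Term.eval_hasTy hD.typed h₁, Term.eval_hasTy hD.typed h₂, h₃,
      Term.eval_ne_null hD.typed hD.ne_null h₁ (hn.1 _ (List.getElem_mem hi)),
      Term.eval_ne_null hD.typed hD.ne_null h₂ (hn.2 _ (List.getElem_mem hi'))⟩
  | .mem ts E, _, _, _, _, hθ, hn, hD => by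
    simp only [Cond.WF, Cond.NoNull, Cond.eval] at hθ hn ⊢
    rw [Expr.eval_eq_of_nullFree hM hM' hθ.1 hn.2 hD]
    exact rel_map fun B hB => sameBool_disj_map fun b hb => sameBool_cmpTuple hM hM'
      (comparable_row hD hθ.2 hn.1 (Expr.eval_typed M' hθ.1 hD.isOver hD.typed hB b hb)
        (Expr.null_notMem M' hθ.1 hn.2 hD hB b hb))
  | .empty E, _, _, _, _, hθ, hn, hD => by
    simp only [Cond.WF, Cond.NoNull, Cond.eval] at hθ hn ⊢
    rw [Expr.eval_eq_of_nullFree hM hM' hθ hn hD]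
    exact rel_map fun B _ => ⟨_, rfl, rfl⟩
  | .any ts ω E, _, _, _, _, hθ, hn, hD => by
    simp only [Cond.WF, Cond.NoNull, Cond.eval] at hθ hn ⊢
    rw [Expr.eval_eq_of_nullFree hM hM' hθ.1 hn.2 hD]
    exact rel_map fun B hB => sameBool_disj_map fun b hb => sameBool_cmpTuple hM hM'
      (comparable_row hD hθ.2 hn.1 (Expr.eval_typed M' hθ.1 hD.isOver hD.typed hB b hb)
        (Expr.null_notMem M' hθ.1 hn.2 hD hB b hb))
  | .all ts ω E, _, _, _, _, hθ, hn, hD => by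
    simp only [Cond.WF, Cond.NoNull, Cond.eval] at hθ hn ⊢
    rw [Expr.eval_eq_of_nullFree hM hM' hθ.1 hn.2 hD]
    exact rel_map fun B hB => sameBool_conj_map fun b hb => sameBool_cmpTuple hM hM'
      (comparable_row hD hθ.2 hn.1 (Expr.eval_typed M' hθ.1 hD.isOver hD.typed hB b hb)
        (Expr.null_notMem M' hθ.1 hn.2 hD hB b hb))
  | .or θ₁ θ₂, _, _, D, η, hθ, hn, hD => by
    simp only [Cond.WF, Cond.NoNull, Cond.eval] at hθ hn ⊢
    have h₁ := Cond.sameBool_of_nullFree hM hM' hθ.1 hn.1 hD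
    have h₂ := Cond.sameBool_of_nullFree hM hM' hθ.2 hn.2 hD
    generalize θ₁.eval M D η = x₁, θ₁.eval M' D η = y₁, θ₂.eval M D η = x₂,
      θ₂.eval M' D η = y₂ at h₁ h₂
    cases h₁ with
    | none => exact .none
    | some h₁ =>
      cases h₂ with
      | none => exact .none
      | some h₂ => exact .some (h₁.or h₂)
  | .and θ₁ θ₂, _, _, D, η, hθ, hn, hD => by
    simp only [Cond.WF, Cond.NoNull, Cond.eval] at hθ hn ⊢
    have h₁ := Cond.sameBool_of_nullFree hM hM' hθ.1 hn.1 hD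
    have h₂ := Cond.sameBool_of_nullFree hM hM' hθ.2 hn.2 hD
    generalize θ₁.eval M D η = x₁, θ₁.eval M' D η = y₁, θ₂.eval M D η = x₂,
      θ₂.eval M' D η = y₂ at h₁ h₂
    cases h₁ with
    | none => exact .none
    | some h₁ =>
      cases h₂ with
      | none => exact .none
      | some h₂ => exact .some (h₁.and h₂)
  | .not θ, _, _, D, η, hθ, hn, hD => by
    simp only [Cond.WF, Cond.NoNull, Cond.eval] at hθ hn ⊢
    have h := Cond.sameBool_of_nullFree hM hM' hθ hn hD
    generalize θ.eval M D η = x, θ.eval M' D η = y at h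
    cases h with
    | none => exact .none
    | some h => exact .some h.neg

end

end Agreement

end RASQL

theorem theorem4 (V : RASQL.Vocab) (hcount : V.HasCount) (hmod : V.HasMod)
    (L : RASQL.Lang) (S : Set (RASQL.RelSym V))
    {T : Type} [Finite T] (M : RASQL.Semantics V T)
    (hM : M.Expressible L S) : M.Captures L S where
  to_sql _ hE := RASQL.exists_expr_value_eq hcount hmod RASQL.sql_standard.standardOnNum
    (fun bs _ _ => hM.definableIn_sql bs) hE
  from_sql _ hE := RASQL.exists_expr_value_eq hcount hmod hM.standard.standardOnNum
    (fun _ hne hbs => (RASQL.exists_witnesses hne hbs).elim fun _ hU => hM.standard.definableIn hU)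
    hE
  null_free _ hE hn D hD hD' := RASQL.Expr.eval_eq_of_nullFree RASQL.sql_standard hM.standard hE.1
    hn ⟨hD.mono (by simp), fun R hR => hD' R (by simpa using hR), RASQL.Env.typed_empty, by simp⟩
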